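/- A *finite directed graph* is a finite nonempty set $V$ with a binary edge relation $E$, and FO denotes first-order logic in the vocabulary $\{E\}$ with equality. *Unbounded depth.* Let $\varphi(P,v_1,\dots,v_r,v_{r+1},\dots,v_s)$ be a first-order formula in the vocabulary $\{E,P\}$ in which the $r$-ary predicate $P$ occurs only positively. For a finite directed graph $G$ and parameters $a_{r+1},\dots,a_s\in V(G)$ put $P_0=\emptyset$ and $P_{i+1}=\{(v_1,\dots,v_r) : G\models\varphi(P_i,v_1,\dots,v_r,a_{r+1},\dots,a_s)\}$. A set $\mathcal J$ of finite directed graphs *admits fixed points of unbounded depth* if for some such $\varphi$ there is no $j\in\mathbb N$ such that $P_j=\bigcup_i P_i$ for all $G\in\mathcal J$ and all parameters in $G$. *Logics.* Expand a directed graph with $n$ vertices to a two-sorted structure whose second sort is the set of numbers $\{0,\dots,n-1\}$ with the usual order. (FO+COUNT+LFP) is the closure of the atomic formulas (edges and equality between vertices, order and equality between numbers, relation variables over tuples of vertices and numbers) under Boolean connectives, quantification over vertices and over numbers, counting quantifiers $(\exists^{\ge i}x)\,\varphi$ ("there are at least $i$ vertices $x$ with $\varphi$", $i$ a number variable), and the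 least fixed point operator, applied to formulas positive in a relation variable over tuples of vertices and numbers. $(L+\mathrm{COUNT})^\omega_{\infty\omega}$ is built from the atomic formulas without relation variables by negation, conjunctions and disjunctions of arbitrary families of formulas, quantification over vertices and over numbers, and counting quantifiers $(\exists^{\ge i}x)$ with $i$ a number variable or a fixed natural number, where each formula contains only finitely many variables, free or bound. In both logics consider the formulas all of whose free variables are vertex variables. Such a formula is *first-order expressible on* $\mathcal J$ if there is one FO formula that is equivalent to it in every $G\in\mathcal J$ for all values of the free variables. **Theorem.** 1. There is a set $\mathcal J=\{J_1,J_2,\dots\}$ of finite directed graphs that admits fixed points of unbounded depth and on which FO = (FO+COUNT+LFP), that is, every formula of (FO+COUNT+LFP) is first-order expressible on $\mathcal J$. 2. For every countable set $\mathcal S$ of formulas of $(L+\mathrm{COUNT})^\omega_{\infty\omega}$ there is a set $\mathcal J=\{J_1,J_2,\dots\}$ of finite directed graphs that admits fixed points of unbounded depth and on which every formula of $\mathcal S$ is first-order expressible. -/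

import Mathlib

open FirstOrder

/-- A finite directed graph: a finite nonempty vertex set with an arbitrary binary edge relation. -/
structure FinDigraph where
  V : Type
  [fin : Finite V]
  [nonempty : Nonempty V]
  graph : Digraph V

namespace FinDigraph

attribute [instance] FinDigraph.fin FinDigraph.nonempty

/-- The number sort `{0, …, n - 1}`, where `n` is the number of vertices. -/
abbrev Num (G : FinDigraph) : Type := Fin (Nat.card G.V)

/-- A directed graph as a first-order structure with one binary relation symbol. -/
instance graphStructure (G : FinDigraph) : Language.graph.Structure G.V where
  RelMap := fun {_} R v =>
    match R, v with
    | .adj, v => G.graph.Adj (v 0) (v 1)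

end FinDigraph

/-! ### Positive elementary inductions -/

/-- The relation symbols `E` (binary) and `P` (`r`-ary). -/
inductive GraphPredRel (r : ℕ) : ℕ → Type
  | adj : GraphPredRel r 2
  | pred : GraphPredRel r r

/-- The vocabulary of graphs together with an additional `r`-ary predicate `P`. -/
def graphPredLang (r : ℕ) : Language := ⟨fun _ => Empty, GraphPredRel r⟩

/-- The expansion of the directed graph `G` by the interpretation `P` of the predicate. -/
abbrev FinDigraph.expand (G : FinDigraph) {r : ℕ} (P : Set (Fin r → G.V)) :
    (graphPredLang r).Structure G.V where
  funMap := fun f _ => f.elim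
  RelMap := fun {_} R v =>
    match R, v with
    | .adj, v => G.graph.Adj (v 0) (v 1)
    | .pred, v => v ∈ P

/-- An atomic formula with this relation symbol, in a place of polarity `b`, is no negative
occurrence of `P`. -/
def GraphPredRel.Allowed {r : ℕ} (b : Bool) : {n : ℕ} → GraphPredRel r n → Prop
  | _, .adj => True
  | _, .pred => b = true

/-- All occurrences of `P` in the formula have polarity `b` (`true`: all are positive, `false`: all
are negative). -/
def PredPolarity {r : ℕ} {α : Type} :
    Bool → {n : ℕ} → (graphPredLang r).BoundedFormula α n → Prop
  | _, _, .falsum => True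
  | _, _, .equal _ _ => True
  | b, _, .rel R _ => GraphPredRel.Allowed (r := r) b R
  | b, _, .imp φ ψ => PredPolarity (!b) φ ∧ PredPolarity b ψ
  | b, _, .all φ => PredPolarity b φ

/-- The operator `P ↦ {v | G ⊨ φ(P, v, a)}` of a first-order formula `φ` whose free variables are
`v` (the `r` variables on the left) and the parameters `a` (the `s` variables on the right). -/
def FinDigraph.inductionStep (G : FinDigraph) {r s : ℕ}
    (φ : (graphPredLang r).Formula (Fin r ⊕ Fin s)) (a : Fin s → G.V)
    (P : Set (Fin r → G.V)) : Set (Fin r → G.V) :=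
  {v | @Language.Formula.Realize (graphPredLang r) G.V (G.expand P) _ φ (Sum.elim v a)}

/-- The stages `P_0 = ∅`, `P_{i+1} = {v | G ⊨ φ(P_i, v, a)}`. -/
def FinDigraph.stage (G : FinDigraph) {r s : ℕ}
    (φ : (graphPredLang r).Formula (Fin r ⊕ Fin s)) (a : Fin s → G.V) (i : ℕ) :
    Set (Fin r → G.V) :=
  (G.inductionStep φ a)^[i] ∅

/-- The induction given by `φ` is bounded in `K`: some `j` has `P_j = ⋃ i, P_i` for all graphs in
`K` and all parameters. -/
def InductionBoundedOn (K : Set FinDigraph) {r s : ℕ}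
    (φ : (graphPredLang r).Formula (Fin r ⊕ Fin s)) : Prop :=
  ∃ j : ℕ, ∀ G ∈ K, ∀ a : Fin s → G.V, G.stage φ a j = ⋃ i, G.stage φ a i

/-- `K` admits fixed points of unbounded depth: some positive elementary induction is not bounded
in `K`. -/
def AdmitsUnboundedFixedPoints (K : Set FinDigraph) : Prop :=
  ∃ (r s : ℕ) (φ : (graphPredLang r).Formula (Fin r ⊕ Fin s)),
    PredPolarity true φ ∧ ¬ InductionBoundedOn K φ

/-! ### First-order logic with counting and least fixed points

The logic speaks about two-sorted structures: the vertices with the edge relation, and the numbers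
`{0, …, n - 1}` with their order. -/

/-- Formulas of `FO + COUNT + LFP` over directed graphs. `FPC Γ k l` are the expressions with free
vertex variables `Fin k`, free number variables `Fin l`, and free relation variables listed in `Γ`,
where `(r, q)` stands for a relation between `r` vertices and `q` numbers. A quantifier binds the
last variable of the larger context. Positivity is imposed by `FPC.WellFormed`. -/
inductive FPC : List (ℕ × ℕ) → ℕ → ℕ → Type
  | adj {Γ : List (ℕ × ℕ)} {k l : ℕ} (x y : Fin k) : FPC Γ k l
  | eq {Γ : List (ℕ × ℕ)} {k l : ℕ} (x y : Fin k) : FPC Γ k l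
  | numLe {Γ : List (ℕ × ℕ)} {k l : ℕ} (i j : Fin l) : FPC Γ k l
  | numEq {Γ : List (ℕ × ℕ)} {k l : ℕ} (i j : Fin l) : FPC Γ k l
  | rel {Γ : List (ℕ × ℕ)} {k l : ℕ} (X : Fin Γ.length)
      (xs : Fin (Γ.get X).1 → Fin k) (is : Fin (Γ.get X).2 → Fin l) : FPC Γ k l
  | neg {Γ : List (ℕ × ℕ)} {k l : ℕ} (φ : FPC Γ k l) : FPC Γ k l
  | and {Γ : List (ℕ × ℕ)} {k l : ℕ} (φ ψ : FPC Γ k l) : FPC Γ k l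
  /-- there is a vertex -/
  | ex {Γ : List (ℕ × ℕ)} {k l : ℕ} (φ : FPC Γ (k + 1) l) : FPC Γ k l
  /-- there is a number -/
  | numEx {Γ : List (ℕ × ℕ)} {k l : ℕ} (φ : FPC Γ k (l + 1)) : FPC Γ k l
  /-- there are at least `i` vertices -/
  | count {Γ : List (ℕ × ℕ)} {k l : ℕ} (i : Fin l) (φ : FPC Γ (k + 1) l) : FPC Γ k l
  /-- the tuple `(xs, is)` is in the least fixed point of `φ`, which defines a relation between the
  last `r` vertex variables and the last `q` number variables -/
  | lfp {Γ : List (ℕ × ℕ)} {k l : ℕ} (r q : ℕ) (φ : FPC ((r, q) :: Γ) (k + r) (l + q))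
      (xs : Fin r → Fin k) (is : Fin q → Fin l) : FPC Γ k l

namespace FPC

/-- All free occurrences of the relation variable `X` have polarity `b`. -/
def Polarity : {Γ : List (ℕ × ℕ)} → {k l : ℕ} → FPC Γ k l → Bool → Fin Γ.length → Prop
  | _, _, _, .adj _ _, _, _ => True
  | _, _, _, .eq _ _, _, _ => True
  | _, _, _, .numLe _ _, _, _ => True
  | _, _, _, .numEq _ _, _, _ => True
  | _, _, _, .rel Y _ _, b, X => Y = X → b = true
  | _, _, _, .neg φ, b, X => Polarity φ (!b) X
  | _, _, _, .and φ ψ, b, X => Polarity φ b X ∧ Polarity ψ b X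
  | _, _, _, .ex φ, b, X => Polarity φ b X
  | _, _, _, .numEx φ, b, X => Polarity φ b X
  | _, _, _, .count _ φ, b, X => Polarity φ b X
  | _, _, _, .lfp _ _ φ _ _, b, X => Polarity φ b X.succ

/-- The fixed-point operator is applied only to formulas in which the relation variable that it
binds has positive occurrences only. -/
def WellFormed : {Γ : List (ℕ × ℕ)} → {k l : ℕ} → FPC Γ k l → Prop
  | _, _, _, .adj _ _ => True
  | _, _, _, .eq _ _ => True
  | _, _, _, .numLe _ _ => True
  | _, _, _, .numEq _ _ => True
  | _, _, _, .rel _ _ _ => True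
  | _, _, _, .neg φ => WellFormed φ
  | _, _, _, .and φ ψ => WellFormed φ ∧ WellFormed ψ
  | _, _, _, .ex φ => WellFormed φ
  | _, _, _, .numEx φ => WellFormed φ
  | _, _, _, .count _ φ => WellFormed φ
  | _, _, _, .lfp _ _ φ _ _ => Polarity φ true (0 : Fin (_ + 1)) ∧ WellFormed φ

/-- Interpretations of the relation variables in `Γ`. -/
abbrev RelAssignment (G : FinDigraph) (Γ : List (ℕ × ℕ)) : Type :=
  (X : Fin Γ.length) → Set ((Fin (Γ.get X).1 → G.V) × (Fin (Γ.get X).2 → G.Num))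

/-- Interpret the newest relation variable by `P`. -/
def RelAssignment.cons {G : FinDigraph} {Γ : List (ℕ × ℕ)} {r q : ℕ}
    (P : Set ((Fin r → G.V) × (Fin q → G.Num))) (ρ : RelAssignment G Γ) :
    RelAssignment G ((r, q) :: Γ)
  | ⟨0, _⟩ => P
  | ⟨n + 1, h⟩ => ρ ⟨n, Nat.lt_of_succ_lt_succ h⟩

/-- Truth of a formula in `G`, with relation variables interpreted by `ρ`, vertex variables by `a`
and number variables by `ν`. The fixed point is the union of the stages that start with `∅`. -/
def Realize (G : FinDigraph) : {Γ : List (ℕ × ℕ)} → {k l : ℕ} → FPC Γ k l →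
    RelAssignment G Γ → (Fin k → G.V) → (Fin l → G.Num) → Prop
  | _, _, _, .adj x y, _, a, _ => G.graph.Adj (a x) (a y)
  | _, _, _, .eq x y, _, a, _ => a x = a y
  | _, _, _, .numLe i j, _, _, ν => ν i ≤ ν j
  | _, _, _, .numEq i j, _, _, ν => ν i = ν j
  | _, _, _, .rel X xs is, ρ, a, ν => (a ∘ xs, ν ∘ is) ∈ ρ X
  | _, _, _, .neg φ, ρ, a, ν => ¬ Realize G φ ρ a ν
  | _, _, _, .and φ ψ, ρ, a, ν => Realize G φ ρ a ν ∧ Realize G ψ ρ a ν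
  | _, _, _, .ex φ, ρ, a, ν => ∃ v : G.V, Realize G φ ρ (Fin.snoc a v) ν
  | _, _, _, .numEx φ, ρ, a, ν => ∃ m : G.Num, Realize G φ ρ a (Fin.snoc ν m)
  | _, _, _, .count i φ, ρ, a, ν =>
      (ν i : ℕ) ≤ {v : G.V | Realize G φ ρ (Fin.snoc a v) ν}.ncard
  | _, _, _, .lfp _ _ φ xs is, ρ, a, ν =>
      (a ∘ xs, ν ∘ is) ∈ ⋃ n : ℕ,
        (fun P => {p | Realize G φ (RelAssignment.cons P ρ)
          (Fin.append a p.1) (Fin.append ν p.2)})^[n] ∅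

end FPC

/-- A formula of `FO + COUNT + LFP` whose free variables are `m` vertex variables. -/
structure FPCFormula (m : ℕ) where
  formula : FPC [] m 0
  wellFormed : formula.WellFormed

/-- `G ⊨ φ(a)`. -/
def FPCFormula.Realize {m : ℕ} (φ : FPCFormula m) (G : FinDigraph) (a : Fin m → G.V) : Prop :=
  φ.formula.Realize G (fun X => X.elim0) a Fin.elim0

/-! ### Infinitary logic with counting and finitely many variables -/

universe u

/-- Infinitary formulas with counting over directed graphs in which only the vertex variables
`Fin k` and the number variables `Fin l`, free or bound, occur. Universal quantifiers and infinite
conjunctions are obtained with negations. -/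
inductive LCount (k l : ℕ) : Type (u + 1)
  | adj (x y : Fin k) : LCount k l
  | eq (x y : Fin k) : LCount k l
  | numLe (i j : Fin l) : LCount k l
  | numEq (i j : Fin l) : LCount k l
  | neg (φ : LCount k l) : LCount k l
  /-- the disjunction of an arbitrary family of formulas -/
  | iSup (ι : Type u) (φ : ι → LCount k l) : LCount k l
  /-- there is a vertex `x` -/
  | ex (x : Fin k) (φ : LCount k l) : LCount k l
  /-- there is a number `i` -/
  | numEx (i : Fin l) (φ : LCount k l) : LCount k l
  /-- there are at least `i` vertices `x`, for a number variable `i` -/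
  | count (i : Fin l) (x : Fin k) (φ : LCount k l) : LCount k l
  /-- there are at least `m` vertices `x`, for a natural number `m` -/
  | countConst (m : ℕ) (x : Fin k) (φ : LCount k l) : LCount k l

namespace LCount

variable {k l : ℕ}

/-- The free number variables. -/
def freeNum : LCount.{u} k l → Set (Fin l)
  | .adj _ _ => ∅
  | .eq _ _ => ∅
  | .numLe i j => {i, j}
  | .numEq i j => {i, j}
  | .neg φ => φ.freeNum
  | .iSup _ φ => ⋃ t, (φ t).freeNum
  | .ex _ φ => φ.freeNum
  | .numEx i φ => φ.freeNum \ {i}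
  | .count i _ φ => insert i φ.freeNum
  | .countConst _ _ φ => φ.freeNum

/-- Truth of a formula in `G`, with vertex variables interpreted by `a` and number variables by
`ν`. -/
def Realize (G : FinDigraph) : LCount.{u} k l → (Fin k → G.V) → (Fin l → G.Num) → Prop
  | .adj x y, a, _ => G.graph.Adj (a x) (a y)
  | .eq x y, a, _ => a x = a y
  | .numLe i j, _, ν => ν i ≤ ν j
  | .numEq i j, _, ν => ν i = ν j
  | .neg φ, a, ν => ¬ φ.Realize G a ν
  | .iSup _ φ, a, ν => ∃ t, (φ t).Realize G a ν
  | .ex x φ, a, ν => ∃ v : G.V, φ.Realize G (Function.update a x v) ν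
  | .numEx i φ, a, ν => ∃ m : G.Num, φ.Realize G a (Function.update ν i m)
  | .count i x φ, a, ν =>
      (ν i : ℕ) ≤ {v : G.V | φ.Realize G (Function.update a x v) ν}.ncard
  | .countConst m x φ, a, ν =>
      m ≤ {v : G.V | φ.Realize G (Function.update a x v) ν}.ncard

end LCount

/-- A formula of infinitary logic with counting and finitely many variables, all of whose free
variables are vertex variables. -/
structure LCountFormula where
  /-- the number of vertex variables, free or bound -/
  vars : ℕ
  /-- the number of number variables -/
  numVars : ℕ
  formula : LCount.{u} vars numVars
  closed : formula.freeNum = ∅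

/-- `G ⊨ φ(a)`. Number variables are not free in `φ`, so their values are irrelevant and are all
taken to be `0`. -/
def LCountFormula.Realize (φ : LCountFormula.{u}) (G : FinDigraph) (a : Fin φ.vars → G.V) : Prop :=
  φ.formula.Realize G a (fun _ => ⟨0, Nat.card_pos⟩)

/-! ### First-order expressibility -/

/-- The `m`-ary global relation `ρ` is expressed on `K` by a first-order formula over graphs. -/
def FOExpressibleOn (K : Set FinDigraph) {m : ℕ}
    (ρ : (G : FinDigraph) → (Fin m → G.V) → Prop) : Prop :=
  ∃ ψ : Language.graph.Formula (Fin m), ∀ G ∈ K, ∀ a : Fin m → G.V, ψ.Realize a ↔ ρ G a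

/-! Formulas of both logics define queries invariant under a bijective pebble game with finitely
many pebbles (`LCount.realize_iff`, `FPC.exists_width`), and there are only countably many formulas
of (FO+COUNT+LFP). Hence it suffices to make a given sequence of `PebbleQuery`s first-order
expressible on one family of graphs with an unbounded induction (`exists_family_expressing`).

The graphs store the truth tables of the queries, each in a place that its own pebbles cannot read.
The points of a skeleton lie on levels: level 0 consists of numbered labels carrying the bit
relation of binary notation, and on each positive level every tuple of the required length with
entries on lower levels is coded by some point. To every pair of points `x`, `y` with `x` on a lower
level, and every role, a Cai–Fürer–Immerman gadget over a complete graph is attached, which is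
either twisted or not. Its number of rows grows with the level of `y`. A first-order formula with
one variable per row detects a twist, since exactly the untwisted gadgets contain a clique meeting
every row (`not_twisted_iff`). With fewer pebbles than rows the duplicator hides it, by moving the
inconsistency to a row without pebbles (`positions_extend`).

The gadgets from level `l` on have more rows than the query of level `l` has pebbles and arguments.
The truth of that query on a tuple therefore depends only on the twists below level `l` and on a
finite amount of information about the tuple (`SameInfo.mem_positions`, `rel_iff_of_info_eq`). This
information is itself first-order definable (`definable_info`) and is a tuple of points below level
`l`, so some point `y` of level `l` codes it. The gadgets at `y` are twisted so as to record this
tuple and the truth value. As the twists of level `l` depend only on those below, they can be chosen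
by recursion on the level, and the query becomes first-order (`rel_iff_exists_twists`,
`definableAlong_rel`). The finitely many graphs without level `l` are described up to isomorphism
(`foExpressibleOn_range`).

Depth comes from the labels: the accessible part of the bit relation is reached at the label 0, 1,
2, 4, 16, … one stage at a time (`lab_tower_mem_stage_iff`). -/

/-! ### Bijective pebble games -/

/-- The set of pairs of corresponding entries of two tuples. -/
def tuplePairs {α β : Type} {ι : Type} (a : ι → α) (a' : ι → β) : Set (α × β) :=
  Set.range fun i => (a i, a' i)

/-- A winning strategy for the duplicator in the bijective game with `k` pebbles, as a set of
positions. -/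
structure IsBijectiveSystem (G H : FinDigraph) (k : ℕ) (I : Set (Set (G.V × H.V))) : Prop where
  eq_iff : ∀ s ∈ I, ∀ p ∈ s, ∀ p' ∈ s, (p.1 = p'.1 ↔ p.2 = p'.2)
  adj_iff : ∀ s ∈ I, ∀ p ∈ s, ∀ p' ∈ s, (G.graph.Adj p.1 p'.1 ↔ H.graph.Adj p.2 p'.2)
  mono : ∀ s ∈ I, ∀ t ⊆ s, t ∈ I
  extend : ∀ s ∈ I, s.ncard < k → ∃ σ : G.V ≃ H.V, ∀ v, insert (v, σ v) s ∈ I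

/-- A global relation that is invariant under the bijective game with `width` pebbles. -/
structure PebbleQuery where
  arity : ℕ
  width : ℕ
  rel : (G : FinDigraph) → (Fin arity → G.V) → Prop
  invariant : ∀ (G H : FinDigraph) (I : Set (Set (G.V × H.V))), IsBijectiveSystem G H width I →
    ∀ (a : Fin arity → G.V) (a' : Fin arity → H.V), tuplePairs a a' ∈ I → (rel G a ↔ rel H a')

theorem tuplePairs_ncard_le {α β : Type} {m : ℕ} (a : Fin m → α) (a' : Fin m → β) :
    (tuplePairs a a').ncard ≤ m := by
  have := Set.ncard_image_le (f := fun i : Fin m => (a i, a' i)) (s := Set.univ) Set.finite_univ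
  rw [Set.image_univ, Set.ncard_univ, Nat.card_fin] at this
  exact this

theorem tuplePairs_snoc {α β : Type} {m : ℕ} (a : Fin m → α) (a' : Fin m → β) (v : α) (w : β) :
    tuplePairs (Fin.snoc a v : Fin (m + 1) → α) (Fin.snoc a' w : Fin (m + 1) → β) =
      insert (v, w) (tuplePairs a a') := by
  ext p
  simp only [tuplePairs, Set.mem_range, Set.mem_insert_iff]
  constructor
  · rintro ⟨i, rfl⟩
    induction i using Fin.lastCases with
    | last => left; simp
    | cast i => right; exact ⟨i, by simp⟩
  · rintro (rfl | ⟨i, rfl⟩)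
    · exact ⟨Fin.last m, by simp⟩
    · exact ⟨i.castSucc, by simp⟩

theorem tuplePairs_append {α β : Type} {m r : ℕ} (a : Fin m → α) (a' : Fin m → β)
    (b : Fin r → α) (b' : Fin r → β) :
    tuplePairs (Fin.append a b) (Fin.append a' b') = tuplePairs a a' ∪ tuplePairs b b' := by
  ext p
  simp only [tuplePairs, Set.mem_range, Set.mem_union]
  constructor
  · rintro ⟨i, rfl⟩
    induction i using Fin.addCases with
    | left i => left; exact ⟨i, by simp⟩
    | right i => right; exact ⟨i, by simp⟩
  · rintro (⟨i, rfl⟩ | ⟨i, rfl⟩)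
    · exact ⟨Fin.castAdd r i, by simp⟩
    · exact ⟨Fin.natAdd m i, by simp⟩

theorem tuplePairs_comp_subset {α β ι κ : Type} (a : ι → α) (a' : ι → β) (f : κ → ι) :
    tuplePairs (a ∘ f) (a' ∘ f) ⊆ tuplePairs a a' := by
  rintro _ ⟨i, rfl⟩
  exact ⟨f i, rfl⟩

theorem ncard_setOf_eq_of_equiv {α β : Type} (σ : α ≃ β) {p : α → Prop} {p' : β → Prop}
    (h : ∀ v, p v ↔ p' (σ v)) : {v | p v}.ncard = {v | p' v}.ncard := by
  have : {v | p' v} = σ '' {v | p v} := by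
    ext w
    simp only [Set.mem_ofPred_eq, Set.mem_image]
    constructor
    · intro hw
      exact ⟨σ.symm w, (h _).2 (by simpa using hw), by simp⟩
    · rintro ⟨v, hv, rfl⟩
      exact (h v).1 hv
  rw [this, Set.ncard_image_of_injective _ σ.injective]

namespace IsBijectiveSystem

variable {G H : FinDigraph} {k : ℕ} {I : Set (Set (G.V × H.V))}

theorem card_eq (hI : IsBijectiveSystem G H k I) (hk : 0 < k) {s : Set (G.V × H.V)} (hs : s ∈ I) :
    Nat.card G.V = Nat.card H.V := by
  obtain ⟨σ, -⟩ := hI.extend ∅ (hI.mono s hs ∅ (Set.empty_subset _)) (by simpa using hk)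
  exact Nat.card_congr σ

/-- A single bijection makes the two number sorts equally large, so number variables are matched by
value and cost no pebbles. -/
theorem exists_num_iff (hI : IsBijectiveSystem G H k I) (hk : 0 < k) {s : Set (G.V × H.V)}
    (hs : s ∈ I) {p : G.Num → Prop} {p' : H.Num → Prop}
    (h : ∀ (i : G.Num) (j : H.Num), (i : ℕ) = j → (p i ↔ p' j)) : (∃ i, p i) ↔ ∃ j, p' j := by
  have hc := hI.card_eq hk hs
  constructor
  · rintro ⟨i, hi⟩
    exact ⟨⟨i, i.2.trans_eq hc⟩, (h _ _ rfl).1 hi⟩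
  · rintro ⟨j, hj⟩
    exact ⟨⟨j, j.2.trans_eq hc.symm⟩, (h _ _ rfl).2 hj⟩

end IsBijectiveSystem

/-! ### Infinitary formulas are pebble queries -/

theorem LCount.realize_iff {k l : ℕ} (φ : LCount.{u} k l) {G H : FinDigraph}
    {I : Set (Set (G.V × H.V))} (hI : IsBijectiveSystem G H (k + 1) I) :
    ∀ (a : Fin k → G.V) (a' : Fin k → H.V) (ν : Fin l → G.Num) (ν' : Fin l → H.Num),
      tuplePairs a a' ∈ I → (∀ i, (ν i : ℕ) = ν' i) → (φ.Realize G a ν ↔ φ.Realize H a' ν') := by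
  -- The old pair at `x` stays on the board while the bijection is chosen and is dropped by `mono`
  -- afterwards; this is what the extra pebble is for.
  have key : ∀ (a : Fin k → G.V) (a' : Fin k → H.V) (x : Fin k), tuplePairs a a' ∈ I →
      ∃ σ : G.V ≃ H.V, ∀ v,
        tuplePairs (Function.update a x v) (Function.update a' x (σ v)) ∈ I := by
    intro a a' x ha
    obtain ⟨σ, hσ⟩ := hI.extend _ ha (Nat.lt_succ_of_le (tuplePairs_ncard_le a a'))
    refine ⟨σ, fun v => hI.mono _ (hσ v) _ ?_⟩
    rintro _ ⟨i, rfl⟩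
    by_cases hi : i = x
    · subst hi
      simp
    · simp only [Function.update_of_ne hi]
      exact Set.mem_insert_of_mem _ ⟨i, rfl⟩
  induction φ with
  | adj x y =>
    intro a a' ν ν' ha hν
    exact hI.adj_iff _ ha (a x, a' x) ⟨x, rfl⟩ (a y, a' y) ⟨y, rfl⟩
  | eq x y =>
    intro a a' ν ν' ha hν
    exact hI.eq_iff _ ha (a x, a' x) ⟨x, rfl⟩ (a y, a' y) ⟨y, rfl⟩
  | numLe i j =>
    intro a a' ν ν' ha hν
    simp only [Realize, Fin.le_def, hν]
  | numEq i j =>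
    intro a a' ν ν' ha hν
    simp only [Realize, Fin.ext_iff, hν]
  | neg φ ih =>
    intro a a' ν ν' ha hν
    simp only [Realize, ih a a' ν ν' ha hν]
  | iSup ι φ ih =>
    intro a a' ν ν' ha hν
    simp only [Realize, ih _ a a' ν ν' ha hν]
  | ex x φ ih =>
    intro a a' ν ν' ha hν
    obtain ⟨σ, hσ⟩ := key a a' x ha
    simp only [Realize]
    exact σ.exists_congr fun v => ih _ _ _ _ (hσ v) hν
  | numEx i φ ih =>
    intro a a' ν ν' ha hν
    simp only [Realize]
    refine hI.exists_num_iff (Nat.succ_pos k) ha fun m m' hm => ih _ _ _ _ ha fun j => ?_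
    by_cases hj : j = i
    · subst hj
      simpa using hm
    · simpa [Function.update_of_ne hj] using hν j
  | count i x φ ih =>
    intro a a' ν ν' ha hν
    obtain ⟨σ, hσ⟩ := key a a' x ha
    simp only [Realize]
    rw [hν i, ncard_setOf_eq_of_equiv σ (p' := fun v => φ.Realize H (Function.update a' x v) ν')
      fun v => ih _ _ _ _ (hσ v) hν]
  | countConst m x φ ih =>
    intro a a' ν ν' ha hν
    obtain ⟨σ, hσ⟩ := key a a' x ha
    simp only [Realize]
    rw [ncard_setOf_eq_of_equiv σ (p' := fun v => φ.Realize H (Function.update a' x v) ν')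
      fun v => ih _ _ _ _ (hσ v) hν]

/-- A formula of infinitary counting logic as a pebble query. -/
def LCountFormula.toPebbleQuery (φ : LCountFormula.{u}) : PebbleQuery where
  arity := φ.vars
  width := φ.vars + 1
  rel := φ.Realize
  invariant := fun _ _ _ hI a a' ha => φ.formula.realize_iff hI a a' _ _ ha fun _ => rfl

/-! ### Fixed-point formulas with counting are pebble queries -/

namespace FPC

/-- Two interpretations of the relation variables agree along the positions of `I` that extend the
position given by `a` and `a'`. -/
def RelInvariant {G H : FinDigraph} (I : Set (Set (G.V × H.V))) {Γ : List (ℕ × ℕ)} {k : ℕ}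
    (a : Fin k → G.V) (a' : Fin k → H.V) (ρ : RelAssignment G Γ) (ρ' : RelAssignment H Γ) : Prop :=
  ∀ (X : Fin Γ.length) (b : Fin (Γ.get X).1 → G.V) (b' : Fin (Γ.get X).1 → H.V)
    (μ : Fin (Γ.get X).2 → G.Num) (μ' : Fin (Γ.get X).2 → H.Num),
    tuplePairs a a' ∪ tuplePairs b b' ∈ I → (∀ i, (μ i : ℕ) = μ' i) →
      ((b, μ) ∈ ρ X ↔ (b', μ') ∈ ρ' X)

theorem RelInvariant.mono {G H : FinDigraph} {I : Set (Set (G.V × H.V))}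
    (hI : ∀ s ∈ I, ∀ t ⊆ s, t ∈ I) {Γ : List (ℕ × ℕ)} {k l : ℕ}
    {a : Fin k → G.V} {a' : Fin k → H.V} {c : Fin l → G.V} {c' : Fin l → H.V}
    {ρ : RelAssignment G Γ} {ρ' : RelAssignment H Γ} (h : RelInvariant I a a' ρ ρ')
    (hs : tuplePairs a a' ⊆ tuplePairs c c') : RelInvariant I c c' ρ ρ' :=
  fun X b b' μ μ' hb hμ => h X b b' μ μ' (hI _ hb _ (Set.union_subset_union_left _ hs)) hμ

/-- Fixed points need no infinitary unfolding: every stage is invariant, by induction on its index,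
with the width of the formula under the operator. For this, interpretations of relation variables
are compared only along positions that extend the current parameters. -/
theorem exists_width {Γ : List (ℕ × ℕ)} {k l : ℕ} (φ : FPC Γ k l) :
    ∃ K₀ : ℕ, ∀ K ≥ K₀, ∀ (G H : FinDigraph) (I : Set (Set (G.V × H.V))),
      IsBijectiveSystem G H K I → ∀ (ρ : RelAssignment G Γ) (ρ' : RelAssignment H Γ)
        (a : Fin k → G.V) (a' : Fin k → H.V) (ν : Fin l → G.Num) (ν' : Fin l → H.Num),
        tuplePairs a a' ∈ I → (∀ i, (ν i : ℕ) = ν' i) → RelInvariant I a a' ρ ρ' →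
          (φ.Realize G ρ a ν ↔ φ.Realize H ρ' a' ν') := by
  induction φ with
  | adj x y =>
    refine ⟨0, fun K _ G H I hI ρ ρ' a a' ν ν' ha hν hρ => ?_⟩
    exact hI.adj_iff _ ha (a x, a' x) ⟨x, rfl⟩ (a y, a' y) ⟨y, rfl⟩
  | eq x y =>
    refine ⟨0, fun K _ G H I hI ρ ρ' a a' ν ν' ha hν hρ => ?_⟩
    exact hI.eq_iff _ ha (a x, a' x) ⟨x, rfl⟩ (a y, a' y) ⟨y, rfl⟩
  | numLe i j =>
    refine ⟨0, fun K _ G H I hI ρ ρ' a a' ν ν' ha hν hρ => ?_⟩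
    simp only [Realize, Fin.le_def, hν]
  | numEq i j =>
    refine ⟨0, fun K _ G H I hI ρ ρ' a a' ν ν' ha hν hρ => ?_⟩
    simp only [Realize, Fin.ext_iff, hν]
  | rel X xs is =>
    refine ⟨0, fun K _ G H I hI ρ ρ' a a' ν ν' ha hν hρ => ?_⟩
    refine hρ X _ _ _ _ ?_ fun i => hν (is i)
    rwa [Set.union_eq_left.2 (tuplePairs_comp_subset a a' xs)]
  | neg φ ih =>
    obtain ⟨K₀, h⟩ := ih
    refine ⟨K₀, fun K hK G H I hI ρ ρ' a a' ν ν' ha hν hρ => ?_⟩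
    simp only [Realize, h K hK G H I hI ρ ρ' a a' ν ν' ha hν hρ]
  | and φ ψ ih₁ ih₂ =>
    obtain ⟨K₁, h₁⟩ := ih₁
    obtain ⟨K₂, h₂⟩ := ih₂
    refine ⟨max K₁ K₂, fun K hK G H I hI ρ ρ' a a' ν ν' ha hν hρ => ?_⟩
    simp only [Realize, h₁ K (le_of_max_le_left hK) G H I hI ρ ρ' a a' ν ν' ha hν hρ,
      h₂ K (le_of_max_le_right hK) G H I hI ρ ρ' a a' ν ν' ha hν hρ]
  | @ex Γ k l φ ih =>
    obtain ⟨K₀, h⟩ := ih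
    refine ⟨max K₀ (k + 1), fun K hK G H I hI ρ ρ' a a' ν ν' ha hν hρ => ?_⟩
    obtain ⟨σ, hσ⟩ := hI.extend _ ha
      (lt_of_le_of_lt (tuplePairs_ncard_le a a') (le_of_max_le_right hK))
    simp only [Realize]
    refine σ.exists_congr fun v => h K (le_of_max_le_left hK) G H I hI ρ ρ' _ _ _ _ ?_ hν
      (hρ.mono hI.mono ?_)
    · rw [tuplePairs_snoc]
      exact hσ v
    · rw [tuplePairs_snoc]
      exact Set.subset_insert _ _
  | numEx φ ih =>
    obtain ⟨K₀, h⟩ := ih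
    refine ⟨max K₀ 1, fun K hK G H I hI ρ ρ' a a' ν ν' ha hν hρ => ?_⟩
    simp only [Realize]
    refine hI.exists_num_iff (le_of_max_le_right hK) ha fun m m' hm =>
      h K (le_of_max_le_left hK) G H I hI ρ ρ' a a' _ _ ha (fun i => ?_) hρ
    induction i using Fin.lastCases with
    | last => simpa using hm
    | cast i => simpa using hν i
  | @count Γ k l i φ ih =>
    obtain ⟨K₀, h⟩ := ih
    refine ⟨max K₀ (k + 1), fun K hK G H I hI ρ ρ' a a' ν ν' ha hν hρ => ?_⟩
    obtain ⟨σ, hσ⟩ := hI.extend _ ha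
      (lt_of_le_of_lt (tuplePairs_ncard_le a a') (le_of_max_le_right hK))
    simp only [Realize]
    rw [hν i, ncard_setOf_eq_of_equiv σ (p' := fun v => φ.Realize H ρ' (Fin.snoc a' v) ν')
      fun v => h K (le_of_max_le_left hK) G H I hI ρ ρ' (Fin.snoc a v) (Fin.snoc a' (σ v)) ν ν'
        ?_ hν (hρ.mono hI.mono ?_)]
    · rw [tuplePairs_snoc]
      exact hσ v
    · rw [tuplePairs_snoc]
      exact Set.subset_insert _ _
  | @lfp Γ k l r q φ xs is ih =>
    obtain ⟨K₀, h⟩ := ih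
    refine ⟨K₀, fun K hK G H I hI ρ ρ' a a' ν ν' ha hν hρ => ?_⟩
    have stages : ∀ (n : ℕ) (b : Fin r → G.V) (b' : Fin r → H.V) (μ : Fin q → G.Num)
        (μ' : Fin q → H.Num), tuplePairs a a' ∪ tuplePairs b b' ∈ I → (∀ i, (μ i : ℕ) = μ' i) →
        ((b, μ) ∈ (fun P => {p | Realize G φ (RelAssignment.cons P ρ)
            (Fin.append a p.1) (Fin.append ν p.2)})^[n] ∅ ↔
          (b', μ') ∈ (fun P => {p | Realize H φ (RelAssignment.cons P ρ')
            (Fin.append a' p.1) (Fin.append ν' p.2)})^[n] ∅) := by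
      intro n
      induction n with
      | zero =>
        intro b b' μ μ' _ _
        simp
      | succ n ihn =>
        intro b b' μ μ' hb hμ
        rw [Function.iterate_succ_apply', Function.iterate_succ_apply']
        refine h K hK G H I hI _ _ _ _ _ _ (by rwa [tuplePairs_append]) (fun i => ?_) ?_
        · induction i using Fin.addCases with
          | left i => simpa using hν i
          | right i => simpa using hμ i
        -- The tuples `b`, `b'` are dropped from the position: the previous stage depends only on
        -- the outer parameters `a`, `a'`.
        · rintro ⟨X, hX⟩ c c' η η' hc hη
          rw [tuplePairs_append] at hc
          have hc' := hI.mono _ hc _ (Set.union_subset_union_left _ Set.subset_union_left)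
          cases X with
          | zero => exact ihn c c' η η' hc' hη
          | succ X => exact hρ ⟨X, Nat.lt_of_succ_lt_succ hX⟩ c c' η η' hc' hη
    simp only [Realize, Set.mem_iUnion]
    refine exists_congr fun n => stages n _ _ _ _ ?_ fun i => hν (is i)
    rwa [Set.union_eq_left.2 (tuplePairs_comp_subset a a' xs)]

/-! ### Countability of the fixed-point formulas -/

/-- The height of the syntax tree. -/
def rank : {Γ : List (ℕ × ℕ)} → {k l : ℕ} → FPC Γ k l → ℕ
  | _, _, _, .adj _ _ => 0
  | _, _, _, .eq _ _ => 0
  | _, _, _, .numLe _ _ => 0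
  | _, _, _, .numEq _ _ => 0
  | _, _, _, .rel _ _ _ => 0
  | _, _, _, .neg φ => rank φ + 1
  | _, _, _, .and φ ψ => max (rank φ) (rank ψ) + 1
  | _, _, _, .ex φ => rank φ + 1
  | _, _, _, .numEx φ => rank φ + 1
  | _, _, _, .count _ φ => rank φ + 1
  | _, _, _, .lfp _ _ φ _ _ => rank φ + 1

theorem countable_rank_lt (n : ℕ) :
    ∀ (Γ : List (ℕ × ℕ)) (k l : ℕ), {φ : FPC Γ k l | φ.rank < n}.Countable := by
  induction n with
  | zero => simp
  | succ n ih =>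
    intro Γ k l
    have h : ({φ : FPC Γ k l | φ.rank < n + 1}) ⊆
        Set.range (fun p : Fin k × Fin k => FPC.adj p.1 p.2) ∪
        (Set.range (fun p : Fin k × Fin k => FPC.eq p.1 p.2) ∪
        (Set.range (fun p : Fin l × Fin l => FPC.numLe p.1 p.2) ∪
        (Set.range (fun p : Fin l × Fin l => FPC.numEq p.1 p.2) ∪
        (Set.range (fun p : (X : Fin Γ.length) × (Fin (Γ.get X).1 → Fin k) ×
          (Fin (Γ.get X).2 → Fin l) => FPC.rel p.1 p.2.1 p.2.2) ∪
        (FPC.neg '' {φ | φ.rank < n} ∪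
        (Set.image2 FPC.and {φ | φ.rank < n} {φ | φ.rank < n} ∪
        (FPC.ex '' {φ | φ.rank < n} ∪
        (FPC.numEx '' {φ | φ.rank < n} ∪
        ((⋃ i, FPC.count i '' {φ | φ.rank < n}) ∪
        ⋃ (r : ℕ) (q : ℕ) (xs : Fin r → Fin k) (is : Fin q → Fin l),
          (fun φ => FPC.lfp r q φ xs is) '' {φ | φ.rank < n}))))))))) := by
      intro φ hφ
      cases φ with
      | adj x y => exact .inl ⟨(x, y), rfl⟩
      | eq x y => exact .inr (.inl ⟨(x, y), rfl⟩)
      | numLe x y => exact .inr (.inr (.inl ⟨(x, y), rfl⟩))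
      | numEq x y => exact .inr (.inr (.inr (.inl ⟨(x, y), rfl⟩)))
      | rel X xs is => exact .inr (.inr (.inr (.inr (.inl ⟨⟨X, xs, is⟩, rfl⟩))))
      | neg φ =>
        exact .inr (.inr (.inr (.inr (.inr (.inl ⟨φ, Nat.lt_of_succ_lt_succ hφ, rfl⟩)))))
      | and φ ψ =>
        have := max_lt_iff.1 (Nat.lt_of_succ_lt_succ hφ)
        exact .inr (.inr (.inr (.inr (.inr (.inr (.inl ⟨φ, this.1, ψ, this.2, rfl⟩))))))
      | ex φ =>
        exact .inr (.inr (.inr (.inr (.inr (.inr (.inr (.inl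
          ⟨φ, Nat.lt_of_succ_lt_succ hφ, rfl⟩)))))))
      | numEx φ =>
        exact .inr (.inr (.inr (.inr (.inr (.inr (.inr (.inr (.inl
          ⟨φ, Nat.lt_of_succ_lt_succ hφ, rfl⟩))))))))
      | count i φ =>
        exact .inr (.inr (.inr (.inr (.inr (.inr (.inr (.inr (.inr (.inl
          (Set.mem_iUnion.2 ⟨i, φ, Nat.lt_of_succ_lt_succ hφ, rfl⟩))))))))))
      | lfp r q φ xs is =>
        refine .inr (.inr (.inr (.inr (.inr (.inr (.inr (.inr (.inr (.inr ?_)))))))))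
        simp only [Set.mem_iUnion]
        exact ⟨r, q, xs, is, φ, Nat.lt_of_succ_lt_succ hφ, rfl⟩
    refine Set.Countable.mono h ?_
    refine (Set.countable_range _).union <| (Set.countable_range _).union <|
      (Set.countable_range _).union <| (Set.countable_range _).union <|
      (Set.countable_range _).union <| ((ih _ _ _).image _).union <|
      ((ih _ _ _).image2 (ih _ _ _) _).union <| ((ih _ _ _).image _).union <|
      ((ih _ _ _).image _).union <|
      (Set.countable_iUnion fun _ => (ih _ _ _).image _).union <|
      Set.countable_iUnion fun _ => Set.countable_iUnion fun _ =>
        Set.countable_iUnion fun _ => Set.countable_iUnion fun _ => (ih _ _ _).image _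

instance countable_formulas (Γ : List (ℕ × ℕ)) (k l : ℕ) : Countable (FPC Γ k l) := by
  rw [← Set.countable_univ_iff]
  refine Set.Countable.mono (fun φ _ => ?_)
    (Set.countable_iUnion fun n => countable_rank_lt n Γ k l)
  exact Set.mem_iUnion.2 ⟨φ.rank + 1, Nat.lt_succ_self _⟩

end FPC

instance FPCFormula.countable_formulas (m : ℕ) : Countable (FPCFormula m) :=
  Function.Injective.countable (f := FPCFormula.formula) fun φ ψ h => by
    cases φ; cases ψ; simpa using h

theorem FPCFormula.exists_pebbleQuery {m : ℕ} (φ : FPCFormula m) :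
    ∃ k : ℕ, ∀ (G H : FinDigraph) (I : Set (Set (G.V × H.V))), IsBijectiveSystem G H k I →
      ∀ (a : Fin m → G.V) (a' : Fin m → H.V), tuplePairs a a' ∈ I →
        (φ.Realize G a ↔ φ.Realize H a') := by
  obtain ⟨K, h⟩ := φ.formula.exists_width
  exact ⟨K, fun G H I hI a a' ha => h K le_rfl G H I hI _ _ a a' _ _ ha (fun i => i.elim0)
    fun X => X.elim0⟩

/-- A formula of `FO + COUNT + LFP` as a pebble query. -/
noncomputable def FPCFormula.toPebbleQuery {m : ℕ} (φ : FPCFormula m) : PebbleQuery where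
  arity := m
  width := φ.exists_pebbleQuery.choose
  rel := φ.Realize
  invariant := φ.exists_pebbleQuery.choose_spec

/-- The duplicator always answers with `e`; the winning positions are the subsets of its graph. -/
theorem PebbleQuery.rel_iff_of_iso (q : PebbleQuery) {G H : FinDigraph} (e : G.V ≃ H.V)
    (he : ∀ x y, G.graph.Adj x y ↔ H.graph.Adj (e x) (e y)) (a : Fin q.arity → G.V) :
    q.rel G a ↔ q.rel H (e ∘ a) := by
  refine q.invariant G H {s | ∀ p ∈ s, p.2 = e p.1} ⟨?_, ?_, ?_, ?_⟩ a (e ∘ a) ?_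
  · intro s hs p hp p' hp'
    rw [hs p hp, hs p' hp', e.apply_eq_iff_eq]
  · intro s hs p hp p' hp'
    rw [hs p hp, hs p' hp', he]
  · exact fun s hs t ht p hp => hs p (ht hp)
  · intro s hs _
    refine ⟨e, fun v p hp => ?_⟩
    rcases hp with rfl | hp
    exacts [rfl, hs p hp]
  · rintro _ ⟨i, rfl⟩
    rfl

/-! ### Uniform first-order definability in a family of graphs -/

/-- A relation on the graphs `J i` is defined by one first-order formula for all `i` along `l`. -/
def DefinableAlong {ι : Type} (l : Filter ι) (J : ι → FinDigraph) {α : Type}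
    (ρ : (i : ι) → (α → (J i).V) → Prop) : Prop :=
  ∃ ψ : Language.graph.Formula α, ∀ᶠ i in l, ∀ a : α → (J i).V, ψ.Realize a ↔ ρ i a

namespace DefinableAlong

variable {ι : Type} {l : Filter ι} {J : ι → FinDigraph} {α β : Type}
  {ρ σ : (i : ι) → (α → (J i).V) → Prop}

theorem congr_eventually (h : DefinableAlong l J ρ)
    (e : ∀ᶠ i in l, ∀ a, ρ i a ↔ σ i a) : DefinableAlong l J σ := by
  obtain ⟨ψ, hψ⟩ := h
  refine ⟨ψ, ?_⟩
  filter_upwards [hψ, e] with i h₁ h₂ a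
  rw [h₁, h₂]

theorem congr (h : DefinableAlong l J ρ) (e : ∀ i a, ρ i a ↔ σ i a) : DefinableAlong l J σ :=
  h.congr_eventually (Filter.Eventually.of_forall e)

theorem filter_mono {l' : Filter ι} (h : DefinableAlong l J ρ) (hl : l' ≤ l) :
    DefinableAlong l' J ρ := by
  obtain ⟨ψ, hψ⟩ := h
  exact ⟨ψ, hl hψ⟩

theorem adj (s t : α) : DefinableAlong l J fun i a => (J i).graph.Adj (a s) (a t) := by
  exact ⟨Language.Relations.formula₂ (L := Language.graph) .adj (.var s) (.var t),
    Filter.Eventually.of_forall fun i a => Language.Formula.realize_rel₂⟩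

theorem eq (s t : α) : DefinableAlong l J fun _ a => a s = a t := by
  refine ⟨Language.Term.equal (.var s) (.var t), Filter.Eventually.of_forall fun i a => ?_⟩
  rw [Language.Formula.realize_equal]
  exact Iff.rfl

theorem not (h : DefinableAlong l J ρ) : DefinableAlong l J fun i a => ¬ ρ i a := by
  obtain ⟨ψ, hψ⟩ := h
  refine ⟨.not ψ, hψ.mono fun i h a => ?_⟩
  rw [Language.Formula.realize_not, h]

theorem and (h₁ : DefinableAlong l J ρ) (h₂ : DefinableAlong l J σ) :
    DefinableAlong l J fun i a => ρ i a ∧ σ i a := by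
  obtain ⟨ψ, hψ⟩ := h₁
  obtain ⟨χ, hχ⟩ := h₂
  refine ⟨ψ ⊓ χ, (hψ.and hχ).mono fun i h a => ?_⟩
  rw [Language.Formula.realize_inf, h.1, h.2]

theorem or (h₁ : DefinableAlong l J ρ) (h₂ : DefinableAlong l J σ) :
    DefinableAlong l J fun i a => ρ i a ∨ σ i a :=
  (h₁.not.and h₂.not).not.congr fun i a => by tauto

theorem imp (h₁ : DefinableAlong l J ρ) (h₂ : DefinableAlong l J σ) :
    DefinableAlong l J fun i a => ρ i a → σ i a :=
  (h₁.and h₂.not).not.congr fun i a => by tauto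

theorem iff (h₁ : DefinableAlong l J ρ) (h₂ : DefinableAlong l J σ) :
    DefinableAlong l J fun i a => (ρ i a ↔ σ i a) :=
  ((h₁.imp h₂).and (h₂.imp h₁)).congr fun i a => by tauto

theorem forall_finite {κ : Type} [Finite κ] {τ : κ → (i : ι) → (α → (J i).V) → Prop}
    (h : ∀ c, DefinableAlong l J (τ c)) : DefinableAlong l J fun i a => ∀ c, τ c i a := by
  choose ψ hψ using h
  refine ⟨Language.Formula.iInf ψ, (Filter.eventually_all.2 hψ).mono fun i h a => ?_⟩
  rw [Language.Formula.realize_iInf]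
  exact forall_congr' fun c => h c a

theorem exists_finite {κ : Type} [Finite κ] {τ : κ → (i : ι) → (α → (J i).V) → Prop}
    (h : ∀ c, DefinableAlong l J (τ c)) : DefinableAlong l J fun i a => ∃ c, τ c i a :=
  (forall_finite fun c => (h c).not).not.congr fun i a => by push Not; rfl

/-- The formula may be chosen knowing `p`. Facts about one particular finite graph can thus be built
into a uniform formula. -/
theorem const (p : Prop) : DefinableAlong l J (α := α) fun _ _ => p := by
  by_cases hp : p
  · exact (forall_finite (κ := Empty) (τ := fun _ _ _ => False) fun c => c.elim).congr
      fun i a => by simp [hp]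
  · exact (forall_finite (κ := Empty) (τ := fun _ _ _ => False) fun c => c.elim).not.congr
      fun i a => by simp [hp]

theorem exists_tuple {κ : Type} [Finite κ] {τ : (i : ι) → (α → (J i).V) → (κ → (J i).V) → Prop}
    (h : DefinableAlong l J fun i (c : α ⊕ κ → (J i).V) =>
      τ i (fun s => c (.inl s)) fun s => c (.inr s)) :
    DefinableAlong l J fun i a => ∃ x, τ i a x := by
  obtain ⟨ψ, hψ⟩ := h
  refine ⟨Language.Formula.iExs κ ψ, hψ.mono fun i h a => ?_⟩
  rw [Language.Formula.realize_iExs]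
  exact exists_congr fun x => h _

theorem ex {τ : (i : ι) → (α → (J i).V) → (J i).V → Prop}
    (h : DefinableAlong l J fun i (c : α ⊕ Unit → (J i).V) =>
      τ i (fun s => c (.inl s)) (c (.inr ()))) :
    DefinableAlong l J fun i a => ∃ x, τ i a x :=
  (exists_tuple (κ := Unit) (τ := fun i a x => τ i a (x ())) h).congr fun _ _ =>
    ⟨fun ⟨x, hx⟩ => ⟨x (), hx⟩, fun ⟨x, hx⟩ => ⟨fun _ => x, hx⟩⟩

theorem all {τ : (i : ι) → (α → (J i).V) → (J i).V → Prop}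
    (h : DefinableAlong l J fun i (c : α ⊕ Unit → (J i).V) =>
      τ i (fun s => c (.inl s)) (c (.inr ()))) :
    DefinableAlong l J fun i a => ∀ x, τ i a x :=
  (ex (τ := fun i a x => ¬ τ i a x) h.not).not.congr fun i a => by push Not; rfl

end DefinableAlong

/-! ### Finitely many exceptional graphs -/

/-- The map `x` is an isomorphism of directed graphs. -/
def FinDigraph.IsIso {G H : FinDigraph} (x : G.V → H.V) : Prop :=
  (∀ v w, x v = x w → v = w) ∧ (∀ y, ∃ v, x v = y) ∧
    ∀ v w, G.graph.Adj v w ↔ H.graph.Adj (x v) (x w)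

theorem PebbleQuery.rel_iff_of_isIso (q : PebbleQuery) {G H : FinDigraph} {x : G.V → H.V}
    (hx : FinDigraph.IsIso x) (a : Fin q.arity → G.V) : q.rel G a ↔ q.rel H (x ∘ a) :=
  q.rel_iff_of_iso (Equiv.ofBijective x ⟨fun v w h => hx.1 v w h, hx.2.1⟩) hx.2.2 a

section Exceptions

variable {ι : Type} {J : ι → FinDigraph}

/-- The diagram of the finite graph `G`, with one variable for each of its vertices. -/
theorem definableAlong_isIso {α : Type} {l : Filter ι} (G : FinDigraph) (g : G.V → α) :
    DefinableAlong l J fun i (c : α → (J i).V) => FinDigraph.IsIso (G := G) fun v => c (g v) := by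
  refine .and ?_ (.and ?_ ?_)
  · exact .forall_finite fun v => .forall_finite fun w => .imp (.eq _ _) (.const _)
  · refine .all ?_
    exact .exists_finite fun v => .eq (α := α ⊕ Unit) (.inl (g v)) (.inr ())
  · exact .forall_finite fun v => .forall_finite fun w => .iff (.const _) (.adj _ _)

/-- A formula can test whether the graph is isomorphic to `J j`. If so, the relation is copied from
`J j` along any isomorphism, which by invariance is also right for every other isomorphic graph;
otherwise the given formula is used. -/
theorem PebbleQuery.definableAlong_insert (q : PebbleQuery) {A : Set ι} (j : ι)
    (h : DefinableAlong (Filter.principal A) J fun i => q.rel (J i)) :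
    DefinableAlong (Filter.principal (insert j A)) J fun i => q.rel (J i) := by
  obtain ⟨ψ, hψ⟩ := h
  rw [Filter.eventually_principal] at hψ
  have h₁ : DefinableAlong (Filter.principal (insert j A)) J
      fun i (_ : Fin q.arity → (J i).V) => ∃ x : (J j).V → (J i).V, FinDigraph.IsIso x :=
    .exists_tuple (τ := fun i _ x => FinDigraph.IsIso x) (definableAlong_isIso (J j) _)
  have h₂ : DefinableAlong (Filter.principal (insert j A)) J
      fun i (a : Fin q.arity → (J i).V) => ∃ x : (J j).V → (J i).V, FinDigraph.IsIso x ∧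
        ∃ c : Fin q.arity → (J j).V, q.rel (J j) c ∧ ∀ s, a s = x (c s) := by
    refine .exists_tuple (.and (definableAlong_isIso (J j) _) ?_)
    exact .exists_finite fun c => .and (.const _) (.forall_finite fun s =>
      .eq (α := Fin q.arity ⊕ (J j).V) (.inl s) (.inr (c s)))
  have h₃ : DefinableAlong (Filter.principal (insert j A)) J
      fun i (a : Fin q.arity → (J i).V) => ψ.Realize a :=
    ⟨ψ, Filter.Eventually.of_forall fun _ _ => Iff.rfl⟩
  refine ((h₃.and h₁.not).or h₂).congr_eventually ?_
  rw [Filter.eventually_principal]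
  intro i hi a
  by_cases hx : ∃ x : (J j).V → (J i).V, FinDigraph.IsIso x
  · have key : (∃ x : (J j).V → (J i).V, FinDigraph.IsIso x ∧
        ∃ c : Fin q.arity → (J j).V, q.rel (J j) c ∧ ∀ s, a s = x (c s)) ↔ q.rel (J i) a := by
      constructor
      · rintro ⟨x, hx, c, hc, hac⟩
        have := (q.rel_iff_of_isIso hx c).1 hc
        rwa [show a = x ∘ c from funext hac]
      · intro ha
        obtain ⟨x, hx⟩ := hx
        choose c hc using fun s => hx.2.1 (a s)
        refine ⟨x, hx, c, ?_, fun s => (hc s).symm⟩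
        rw [q.rel_iff_of_isIso hx]
        rwa [show x ∘ c = a from funext hc]
    simp only [hx, not_true_eq_false, and_false, false_or, key]
  · rcases hi with rfl | hi
    · exact absurd ⟨id, fun _ _ h => h, fun y => ⟨y, rfl⟩, fun _ _ => Iff.rfl⟩ hx
    · have : ¬ ∃ x : (J j).V → (J i).V, FinDigraph.IsIso x ∧
          ∃ c : Fin q.arity → (J j).V, q.rel (J j) c ∧ ∀ s, a s = x (c s) :=
        fun ⟨x, h, _⟩ => hx ⟨x, h⟩
      simp only [hx, this, not_false_eq_true, and_true, or_false, hψ i hi]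

end Exceptions

theorem PebbleQuery.foExpressibleOn_range (q : PebbleQuery) {J : ℕ → FinDigraph}
    (h : DefinableAlong Filter.atTop J fun n => q.rel (J n)) :
    FOExpressibleOn (Set.range J) q.rel := by
  obtain ⟨ψ, hψ⟩ := h
  obtain ⟨N, hN⟩ := Filter.eventually_atTop.1 hψ
  have key : ∀ d ≤ N, DefinableAlong (Filter.principal {n | N ≤ n + d}) J
      fun n => q.rel (J n) := by
    intro d
    induction d with
    | zero => exact fun _ => ⟨ψ, Filter.eventually_principal.2 hN⟩
    | succ d ih =>
      intro hd
      -- The exceptional indices below `N` are added one at a time, downwards from `N - 1`.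
      refine (q.definableAlong_insert (N - (d + 1)) (ih (Nat.le_of_succ_le hd))).filter_mono ?_
      rw [Filter.principal_mono]
      intro n hn
      simp only [Set.mem_ofPred_eq, Set.mem_insert_iff] at hn ⊢
      omega
  obtain ⟨χ, hχ⟩ := key N le_rfl
  rw [Filter.eventually_principal] at hχ
  refine ⟨χ, ?_⟩
  rintro _ ⟨n, rfl⟩ a
  exact hχ n (Nat.le_add_left N n) a

/-! ### Skeletons -/

/-- Finitely many points on levels `0, …, height`. The points of level `0` are labels, numbered
`0, …, size - 1`. Every tuple with `roles l` entries of level below `l` is coded by a point of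
level `l`. -/
structure LevelledSet (roles : ℕ → ℕ) (size height : ℕ) where
  B : Type
  [fin : Finite B]
  lev : B → ℕ
  num : B → ℕ
  lab : ℕ → B
  dec : B → ℕ → B
  lev_le : ∀ β, lev β ≤ height
  lev_lab : ∀ s, lev (lab s) = 0
  num_lab : ∀ s < size, num (lab s) = s
  num_lt : ∀ β, lev β = 0 → num β < size
  lab_num : ∀ β, lev β = 0 → lab (num β) = β
  exists_dec : ∀ l, 0 < l → l ≤ height → ∀ v : ℕ → B, (∀ t < roles l, lev (v t) < l) →
    ∃ y, lev y = l ∧ ∀ t < roles l, dec y t = v t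

attribute [instance] LevelledSet.fin

theorem LevelledSet.nonempty (roles : ℕ → ℕ) {size : ℕ} (hs : 0 < size) (height : ℕ) :
    Nonempty (LevelledSet roles size height) := by
  induction height with
  | zero =>
    exact ⟨{
      B := Fin size
      lev := fun _ => 0
      num := fun β => β
      lab := fun s => if h : s < size then ⟨s, h⟩ else ⟨0, hs⟩
      dec := fun β _ => β
      lev_le := fun _ => le_rfl
      lev_lab := fun _ => rfl
      num_lab := fun s h => by simp [h]
      num_lt := fun β _ => β.2
      lab_num := fun β _ => by simp
      exists_dec := fun l h₀ h₁ => absurd h₁ (Nat.not_le.2 h₀) }⟩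
  | succ n ih =>
    obtain ⟨S⟩ := ih
    exact ⟨{
      -- Level `n + 1` consists of all tuples of the required length over the points constructed so
      -- far, all of which have level at most `n`.
      B := S.B ⊕ (Fin (roles (n + 1)) → S.B)
      lev := Sum.elim S.lev fun _ => n + 1
      num := Sum.elim S.num fun _ => 0
      lab := fun s => .inl (S.lab s)
      dec := Sum.elim (fun β t => .inl (S.dec β t)) fun v t =>
        if h : t < roles (n + 1) then .inl (v ⟨t, h⟩) else .inl (S.lab 0)
      lev_le := by
        rintro (β | v)
        · exact Nat.le_succ_of_le (S.lev_le β)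
        · exact le_rfl
      lev_lab := S.lev_lab
      num_lab := S.num_lab
      num_lt := by
        rintro (β | v) h
        · exact S.num_lt β h
        · exact absurd h (Nat.succ_ne_zero n)
      lab_num := by
        rintro (β | v) h
        · exact congrArg _ (S.lab_num β h)
        · exact absurd h (Nat.succ_ne_zero n)
      exists_dec := by
        intro l h₀ h₁ v hv
        have hw : ∀ t, ∃ β, t < roles l → v t = .inl β ∧ S.lev β < l := by
          intro t
          by_cases ht : t < roles l
          swap
          · exact ⟨S.lab 0, fun h => absurd h ht⟩
          have := hv t ht
          rcases hvt : v t with β | w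
          · rw [hvt] at this
            exact ⟨β, fun _ => ⟨rfl, this⟩⟩
          · rw [hvt] at this
            exact absurd (lt_of_lt_of_le this h₁) (lt_irrefl _)
        choose w hw using hw
        have hlev := fun t ht => (hw t ht).2
        rcases Nat.lt_or_ge l (n + 1) with hl | hl
        · obtain ⟨y, hy, hdec⟩ := S.exists_dec l h₀ (Nat.le_of_lt_succ hl) w hlev
          exact ⟨.inl y, hy, fun t ht => by simp [hdec t ht, (hw t ht).1]⟩
        · obtain rfl : l = n + 1 := le_antisymm h₁ hl
          exact ⟨.inr fun t => w t, rfl, fun t ht => by simp [ht, (hw t ht).1]⟩ }⟩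

/-- A levelled set of labels and codes together with bounds for the sizes of the gadgets that are
attached to it. -/
structure Skeleton (roles rows : ℕ → ℕ) where
  height : ℕ
  bits : ℕ
  bound : ℕ
  levels : LevelledSet roles (2 ^ bits) height
  roles_le : ∀ l ≤ height, roles l ≤ bound
  rows_le : ∀ l ≤ height, rows l ≤ bound
  pair_lt : ∀ t < bound, ∀ r < bound, Nat.pair t r < bits
  height_lt : height < bits

theorem Skeleton.exists_height (roles rows : ℕ → ℕ) (n : ℕ) :
    ∃ S : Skeleton roles rows, S.height = n := by
  let P := ∑ l ∈ Finset.range (n + 1), (roles l + rows l)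
  -- The summand `(P + 1) ^ 2` exceeds every `Nat.pair t r` with `t, r < P`, and `n + 1` exceeds the
  -- height. With `2 ^ bits` labels, every set of numbers below `bits` is coded by a label.
  obtain ⟨L⟩ := LevelledSet.nonempty roles (size := 2 ^ ((P + 1) ^ 2 + n + 1)) (by positivity) n
  have hP : ∀ l ≤ n, roles l + rows l ≤ P := fun l hl =>
    Finset.single_le_sum (f := fun l => roles l + rows l) (fun _ _ => Nat.zero_le _)
      (Finset.mem_range.2 (Nat.lt_succ_of_le hl))
  refine ⟨⟨n, (P + 1) ^ 2 + n + 1, P, L, ?_, ?_, ?_, ?_⟩, rfl⟩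
  · exact fun l hl => le_trans (Nat.le_add_right _ _) (hP l hl)
  · exact fun l hl => le_trans (Nat.le_add_left _ _) (hP l hl)
  · intro t ht r hr
    have h₁ := Nat.pair_lt_max_add_one_sq t r
    have h₂ : (max t r + 1) ^ 2 ≤ (P + 1) ^ 2 :=
      Nat.pow_le_pow_left (Nat.succ_le_succ (max_le ht.le hr.le)) 2
    omega
  · omega

/-! ### Gadgets -/

/-- The vertices of row `r` of a gadget with `κ` rows: vectors with even coordinate sum. -/
def IsRow {P : ℕ} (κ : ℕ) (r : Fin P) (u : Fin P → ZMod 2) : Prop :=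
  u r = 0 ∧ (∀ s : Fin P, κ ≤ s → u s = 0) ∧ ∑ s, u s = 0

theorem IsRow.zero {P : ℕ} (κ : ℕ) (r : Fin P) : IsRow κ r 0 :=
  ⟨rfl, fun _ _ => rfl, by simp⟩

theorem IsRow.add {P κ : ℕ} {r : Fin P} {u v : Fin P → ZMod 2} (hu : IsRow κ r u)
    (hv : IsRow κ r v) : IsRow κ r (u + v) := by
  refine ⟨by simp [hu.1, hv.1], fun s hs => by simp [hu.2.1 s hs, hv.2.1 s hs], ?_⟩
  simp [Finset.sum_add_distrib, hu.2.2, hv.2.2]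

open Classical in
/-- The matrix that twists the edges between the first two rows if `p` holds. -/
noncomputable def twist {P : ℕ} (p : Prop) (r s : Fin P) : ZMod 2 :=
  if p ∧ ((r : ℕ) = 0 ∧ (s : ℕ) = 1 ∨ (r : ℕ) = 1 ∧ (s : ℕ) = 0) then 1 else 0

theorem twist_comm {P : ℕ} (p : Prop) (r s : Fin P) : twist p r s = twist p s r := by
  unfold twist
  congr 1
  simp only [eq_iff_iff]
  tauto

/-! ### The graph of a skeleton with prescribed twists -/

namespace Skeleton

variable {roles rows : ℕ → ℕ} (S : Skeleton roles rows)

/-- The points of the skeleton. -/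
abbrev B : Type := S.levels.B

/-- The level of a point. -/
abbrev lev (β : S.B) : ℕ := S.levels.lev β

/-- The number of a label. -/
abbrev num (β : S.B) : ℕ := S.levels.num β

/-- The label with a given number. -/
abbrev lab (s : ℕ) : S.B := S.levels.lab s

/-- A vertex of the gadget `(x, y, t)` in row `r`. -/
@[ext]
structure GadgetVertex where
  x : S.B
  y : S.B
  t : Fin S.bound
  r : Fin S.bound
  u : Fin S.bound → ZMod 2
  lev_lt : S.lev x < S.lev y
  t_lt : (t : ℕ) < roles (S.lev y)
  r_lt : (r : ℕ) < rows (S.lev y)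
  row : IsRow (rows (S.lev y)) r u

instance : Finite S.GadgetVertex :=
  Finite.of_injective
    (β := S.B × S.B × Fin S.bound × Fin S.bound × (Fin S.bound → ZMod 2))
    (fun v => (v.x, v.y, v.t, v.r, v.u)) fun v w h => by
      simp only [Prod.mk.injEq] at h
      exact GadgetVertex.ext h.1 h.2.1 h.2.2.1 h.2.2.2.1 h.2.2.2.2

/-- The vertices are the points of the skeleton and the vertices of the gadgets. -/
abbrev Vertex : Type := S.B ⊕ S.GadgetVertex

/-- The edge relation, where `b x y t` tells whether the gadget `(x, y, t)` is twisted. -/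
def Adj (b : S.B → S.B → ℕ → Prop) : S.Vertex → S.Vertex → Prop
  | .inl β, .inl γ => (S.lev β = 0 ∧ S.lev γ = 0 ∧ (S.num γ).testBit (S.num β) = true) ∨
      (S.lev β = 0 ∧ S.lev γ ≠ 0 ∧ S.num β = S.lev γ) ∨ (S.lev β ≠ 0 ∧ β = γ)
  | .inl β, .inr v => β = v.x
  | .inr v, .inl β => β = v.y ∨ (S.lev β = 0 ∧ S.num β = Nat.pair v.t v.r)
  | .inr v, .inr w => v = w ∨ (v.x = w.x ∧ v.y = w.y ∧ v.t = w.t ∧ v.r ≠ w.r ∧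
      v.u w.r + w.u v.r = twist (b v.x v.y v.t) v.r w.r)

/-- The directed graph on the skeleton and the gadgets. -/
abbrev graph (b : S.B → S.B → ℕ → Prop) : FinDigraph where
  V := S.Vertex
  nonempty := ⟨.inl (S.lab 0)⟩
  graph := ⟨S.Adj b⟩

theorem pow_bits_gt : S.bits < 2 ^ S.bits := Nat.lt_two_pow_self

theorem num_lab {s : ℕ} (h : s < S.bits) : S.num (S.lab s) = s :=
  S.levels.num_lab s (h.trans S.pow_bits_gt)

theorem lab_inj {s d : ℕ} (hs : s < 2 ^ S.bits) (hd : d < 2 ^ S.bits) (h : S.lab s = S.lab d) :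
    s = d := by
  rw [← S.levels.num_lab s hs, ← S.levels.num_lab d hd]
  exact congrArg _ h

theorem lev_lt_pow (β : S.B) : S.lev β < 2 ^ S.bits :=
  ((S.levels.lev_le β).trans_lt S.height_lt).trans S.pow_bits_gt

theorem one_lt_pow : 1 < 2 ^ S.bits :=
  Nat.one_lt_two_pow (Nat.pos_of_ne_zero fun h => by have := S.height_lt; omega).ne'

theorem GadgetVertex.pair_lt {S : Skeleton roles rows} (v : S.GadgetVertex) :
    Nat.pair v.t v.r < S.bits :=
  S.pair_lt _ v.t.2 _ v.r.2

/-- The points of the skeleton to which a vertex is attached. -/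
def coord : S.Vertex → Fin 3 → S.B
  | .inl β, _ => β
  | .inr v, c => ![v.x, v.y, S.lab (Nat.pair v.t v.r)] c

open Classical in
/-- The number that codes the set of all `Nat.pair t s` such that some vertex of role `t` in row `s`
distinguishes `v` and `w`. -/
noncomputable def diff (b : S.B → S.B → ℕ → Prop) (v w : S.Vertex) : ℕ :=
  Nat.ofBits fun s : Fin S.bits => decide (∃ z : S.GadgetVertex, Nat.pair z.t z.r = s ∧
    ¬ (S.Adj b (.inr z) v ↔ S.Adj b (.inr z) w))

theorem diff_lt (b : S.B → S.B → ℕ → Prop) (v w : S.Vertex) : S.diff b v w < 2 ^ S.bits :=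
  Nat.ofBits_lt_two_pow _

open Classical in
theorem testBit_diff (b : S.B → S.B → ℕ → Prop) (v w : S.Vertex) (s : ℕ) :
    (S.diff b v w).testBit s = true ↔ ∃ z : S.GadgetVertex, Nat.pair z.t z.r = s ∧
      ¬ (S.Adj b (.inr z) v ↔ S.Adj b (.inr z) w) := by
  by_cases hs : s < S.bits
  · rw [diff, Nat.testBit_ofBits_lt _ _ hs, decide_eq_true_iff]
  · rw [diff, Nat.testBit_ofBits_ge _ _ (Nat.not_lt.1 hs)]
    simp only [Bool.false_eq_true, false_iff, not_exists, not_and]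
    rintro z rfl
    exact absurd z.pair_lt hs

end Skeleton

/-! ### Information about a tuple of vertices -/

/-- The pieces of information about a tuple of `m` vertices. -/
inductive Slot (m : ℕ) : Type
  | unit : Slot m
  | level (s : Fin m) (c : Fin 3) : Slot m
  | low (s : Fin m) (c : Fin 3) : Slot m
  | eq (s : Fin m) (c : Fin 3) (s' : Fin m) (c' : Fin 3) : Slot m
  | adj (s s' : Fin m) : Slot m
  | diff (s s' : Fin m) : Slot m

instance (m : ℕ) : Finite (Slot m) :=
  Finite.of_surjective
    (α := Unit ⊕ (Fin m × Fin 3) ⊕ (Fin m × Fin 3) ⊕ (Fin m × Fin 3 × Fin m × Fin 3) ⊕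
      (Fin m × Fin m) ⊕ (Fin m × Fin m))
    (Sum.elim (fun _ => .unit) <| Sum.elim (fun p => .level p.1 p.2) <|
      Sum.elim (fun p => .low p.1 p.2) <| Sum.elim (fun p => .eq p.1 p.2.1 p.2.2.1 p.2.2.2) <|
      Sum.elim (fun p => .adj p.1 p.2) fun p => .diff p.1 p.2) fun o => by
    cases o with
    | unit => exact ⟨.inl (), rfl⟩
    | level s c => exact ⟨.inr (.inl (s, c)), rfl⟩
    | low s c => exact ⟨.inr (.inr (.inl (s, c))), rfl⟩
    | eq s c s' c' => exact ⟨.inr (.inr (.inr (.inl (s, c, s', c')))), rfl⟩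
    | adj s s' => exact ⟨.inr (.inr (.inr (.inr (.inl (s, s'))))), rfl⟩
    | diff s s' => exact ⟨.inr (.inr (.inr (.inr (.inr (s, s'))))), rfl⟩

namespace Skeleton

variable {roles rows : ℕ → ℕ} (S : Skeleton roles rows)

open Classical in
/-- The information about the tuple `a` that matters on level `l`, as a tuple of points of level
below `l`. -/
noncomputable def info (b : S.B → S.B → ℕ → Prop) (l : ℕ) {m : ℕ} (a : Fin m → S.Vertex) :
    Slot m → S.B
  | .unit => S.lab 0
  | .level s c => S.lab (S.lev (S.coord (a s) c))
  | .low s c => if S.lev (S.coord (a s) c) < l then S.coord (a s) c else S.lab 0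
  | .eq s c s' c' => S.lab (if S.coord (a s) c = S.coord (a s') c' then 1 else 0)
  | .adj s s' => S.lab (if S.Adj b (a s) (a s') then 1 else 0)
  | .diff s s' => S.lab (S.diff b (a s) (a s'))

theorem lev_info_lt (b : S.B → S.B → ℕ → Prop) {l : ℕ} (hl : 0 < l) {m : ℕ}
    (a : Fin m → S.Vertex) (o : Slot m) : S.lev (S.info b l a o) < l := by
  cases o with
  | low s c =>
    simp only [info]
    split_ifs with h
    · exact h
    · exact (S.levels.lev_lab _).trans_lt hl
  | _ => exact (S.levels.lev_lab _).trans_lt hl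

/-- Equality of the information about two tuples, in two graphs on the same vertices. -/
structure SameInfo (b b' : S.B → S.B → ℕ → Prop) (l : ℕ) {m : ℕ} (a a' : Fin m → S.Vertex) :
    Prop where
  lev_eq : ∀ s c, S.lev (S.coord (a s) c) = S.lev (S.coord (a' s) c)
  low_eq : ∀ s c, S.lev (S.coord (a s) c) < l → S.coord (a s) c = S.coord (a' s) c
  eq_iff : ∀ s c s' c', S.coord (a s) c = S.coord (a s') c' ↔ S.coord (a' s) c = S.coord (a' s') c'
  adj_iff : ∀ s s', S.Adj b (a s) (a s') ↔ S.Adj b' (a' s) (a' s')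
  diff_eq : ∀ s s', S.diff b (a s) (a s') = S.diff b' (a' s) (a' s')

-- All pieces except `low` are labels of numbers below `2 ^ bits`, where `lab` is injective, so
-- levels, truth values and difference sets can be recovered.
open Classical in
theorem sameInfo_of_info_eq {b b' : S.B → S.B → ℕ → Prop} {l m : ℕ} {a a' : Fin m → S.Vertex}
    (h : S.info b l a = S.info b' l a') : S.SameInfo b b' l a a' := by
  have flag : ∀ {p p' : Prop} [Decidable p] [Decidable p'],
      S.lab (if p then 1 else 0) = S.lab (if p' then 1 else 0) → (p ↔ p') := by
    intro p p' _ _ h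
    have h1 := S.one_lt_pow
    have := S.lab_inj (by split_ifs <;> omega) (by split_ifs <;> omega) h
    by_cases hp : p <;> by_cases hp' : p' <;> simp_all
  have hlev : ∀ s c, S.lev (S.coord (a s) c) = S.lev (S.coord (a' s) c) := fun s c =>
    S.lab_inj (S.lev_lt_pow _) (S.lev_lt_pow _) (congrFun h (.level s c))
  refine ⟨hlev, fun s c hs => ?_, fun s c s' c' => flag (congrFun h (.eq s c s' c')),
    fun s s' => flag (congrFun h (.adj s s')), fun s s' =>
    S.lab_inj (S.diff_lt _ _ _) (S.diff_lt _ _ _) (congrFun h (.diff s s'))⟩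
  have := congrFun h (.low s c)
  simp only [info] at this
  rwa [if_pos hs, if_pos (hlev s c ▸ hs)] at this

end Skeleton

/-! ### Combinatorial lemmas -/

/-- A partial injection that respects the levels and is the identity below level `l` extends to a
permutation with the same properties. -/
theorem exists_perm_extend {B ι : Type} [Finite ι] (lev : B → ℕ) (l : ℕ) (p p' : ι → B)
    (hlev : ∀ i, lev (p i) = lev (p' i)) (hlow : ∀ i, lev (p i) < l → p i = p' i)
    (heq : ∀ i j, p i = p j ↔ p' i = p' j) :
    ∃ π : Equiv.Perm B, (∀ β, lev (π β) = lev β) ∧ (∀ β, lev β < l → π β = β) ∧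
      ∀ i, π (p i) = p' i := by
  classical
  have := Fintype.ofFinite ι
  suffices H : ∀ A : Finset ι, ∃ π : Equiv.Perm B, (∀ β, lev (π β) = lev β) ∧
      (∀ β, lev β < l → π β = β) ∧ ∀ i ∈ A, π (p i) = p' i by
    obtain ⟨π, h₁, h₂, h₃⟩ := H Finset.univ
    exact ⟨π, h₁, h₂, fun i => h₃ i (Finset.mem_univ i)⟩
  intro A
  induction A using Finset.induction_on with
  | empty => exact ⟨1, fun _ => rfl, fun _ _ => rfl, by simp⟩
  | insert j A hj ih =>
    obtain ⟨π, h₁, h₂, h₃⟩ := ih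
    by_cases hπ : π (p j) = p' j
    · refine ⟨π, h₁, h₂, fun i hi => ?_⟩
      rcases Finset.mem_insert.1 hi with rfl | hi
      exacts [hπ, h₃ i hi]
    · have hl : ¬ lev (p j) < l := fun h => hπ ((h₂ _ h).trans (hlow j h))
      have e₁ : lev (π (p j)) = lev (p j) := h₁ _
      have e₂ : lev (p' j) = lev (p j) := (hlev j).symm
      refine ⟨π.trans (Equiv.swap (π (p j)) (p' j)), fun β => ?_, fun β hβ => ?_, fun i hi => ?_⟩
      · rw [Equiv.trans_apply, Equiv.swap_apply_def]
        split_ifs with h h'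
        · rw [e₂, ← h₁ β, h, e₁]
        · rw [e₁, ← h₁ β, h', e₂]
        · exact h₁ β
      · rw [Equiv.trans_apply, h₂ β hβ, Equiv.swap_apply_of_ne_of_ne]
        · rintro rfl
          exact hl (e₁ ▸ hβ)
        · rintro rfl
          exact hl (e₂ ▸ hβ)
      · rcases Finset.mem_insert.1 hi with rfl | hi
        · simp
        · have hne : p i ≠ p j := fun h => hπ (by rw [← h, h₃ i hi, (heq i j).1 h])
          rw [Equiv.trans_apply, h₃ i hi, Equiv.swap_apply_of_ne_of_ne]
          · rw [← h₃ i hi]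
            exact fun h => hne (π.injective h)
          · exact fun h => hne ((heq i j).2 h)

/-- The entries at `(i, j)` and `(j, i)` cancel modulo 2. This is the parity argument behind the
gadgets, both for hiding a twist and for detecting it. -/
theorem sum_symmetric_eq_zero {ι : Type} (A : Finset ι) (M : ι → ι → ZMod 2)
    (hdiag : ∀ i ∈ A, M i i = 0) (hsymm : ∀ i ∈ A, ∀ j ∈ A, i ≠ j → M i j + M j i = 0) :
    ∑ i ∈ A, ∑ j ∈ A, M i j = 0 := by
  rw [← Finset.sum_product']
  refine Finset.sum_involution (fun p _ => p.swap) ?_ ?_ ?_ ?_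
  · rintro ⟨i, j⟩ h
    obtain ⟨hi, hj⟩ := Finset.mem_product.1 h
    by_cases hij : i = j
    · subst hij
      simp only [Prod.swap]
      rw [hdiag i hi, add_zero]
    · exact hsymm i hi j hj hij
  · rintro ⟨i, j⟩ h h0 hs
    obtain ⟨hi, hj⟩ := Finset.mem_product.1 h
    obtain rfl : j = i := congrArg Prod.fst hs
    exact h0 (hdiag _ hi)
  · rintro ⟨i, j⟩ h
    obtain ⟨hi, hj⟩ := Finset.mem_product.1 h
    exact Finset.mem_product.2 ⟨hj, hi⟩
  · rintro ⟨i, j⟩ _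
    rfl

theorem exists_row_notMem {P κ : ℕ} (hκ : κ ≤ P) (T : Set (Fin P)) (hT : T.ncard < κ) :
    ∃ r : Fin P, (r : ℕ) < κ ∧ r ∉ T := by
  by_contra! h
  have : Set.range (Fin.castLE hκ) ⊆ T := by
    rintro _ ⟨i, rfl⟩
    exact h _ i.2
  have h2 := Set.ncard_le_ncard this
  rw [← Set.image_univ, Set.ncard_image_of_injective _ (Fin.castLE_injective hκ),
    Set.ncard_univ, Nat.card_fin] at h2
  omega

theorem zmod_two_add_self (c : ZMod 2) : c + c = 0 := by
  revert c; decide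

/-- A consistent choice of switchings in the rows of `O` extends to all rows of a gadget, with
inconsistencies only at the row `z`, and with none if nothing has to be switched. -/
theorem exists_rows_extend {P κ : ℕ} (O : Set (Fin P)) (f₀ Δ : Fin P → Fin P → ZMod 2)
    (hΔ : ∀ r s, Δ r s = Δ s r) (hrow : ∀ r ∈ O, IsRow κ r (f₀ r))
    (hpair : ∀ r ∈ O, ∀ s ∈ O, r ≠ s → f₀ r s + f₀ s r = Δ r s)
    (z : Fin P) (hz : z ∉ O) (hzκ : (z : ℕ) < κ) :
    ∃ f : Fin P → Fin P → ZMod 2, (∀ r ∈ O, f r = f₀ r) ∧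
      (∀ r : Fin P, (r : ℕ) < κ → IsRow κ r (f r)) ∧
      (∀ r s : Fin P, r ≠ s → (r : ℕ) < κ → (s : ℕ) < κ → r ≠ z → s ≠ z →
        f r s + f s r = Δ r s) ∧
      ((∀ r s, Δ r s = 0) → ∀ r s : Fin P, r ≠ s → (r : ℕ) < κ → (s : ℕ) < κ →
        f r s + f s r = Δ r s) := by
  classical
  -- For a row outside `O`, entries towards rows of `O` are forced; between two rows outside `O`,
  -- the smaller one carries `Δ`. In `g` the coordinate `z` then absorbs the parity of the row,
  -- which spoils the equations only at `z`.
  let h : Fin P → Fin P → ZMod 2 := fun r s => if s = r ∨ κ ≤ s then 0 else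
    if s ∈ O then Δ r s + f₀ s r else if r < s then Δ r s else 0
  let g : Fin P → Fin P → ZMod 2 := fun r s => if r ∈ O then f₀ r s else
    if s = z then ∑ s' ∈ Finset.univ.erase z, h r s' else h r s
  have hg : ∀ r : Fin P, r ≠ z → (r : ℕ) < κ → IsRow κ r (g r) := by
    intro r hrz hr
    by_cases hrO : r ∈ O
    · have : g r = f₀ r := funext fun s => by simp [g, hrO]
      rw [this]
      exact hrow r hrO
    · refine ⟨by simp [g, hrO, hrz, h], fun s hs => ?_, ?_⟩
      · have : s ≠ z := by
          rintro rfl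
          omega
        simp [g, hrO, this, h, hs]
      · rw [← Finset.add_sum_erase _ _ (Finset.mem_univ z)]
        have e : ∑ s ∈ Finset.univ.erase z, g r s = ∑ s ∈ Finset.univ.erase z, h r s :=
          Finset.sum_congr rfl fun s hs => by simp [g, hrO, Finset.ne_of_mem_erase hs]
        rw [e]
        simp only [g, hrO, if_false, if_true]
        exact zmod_two_add_self _
  have hgpair : ∀ r s : Fin P, r ≠ s → (r : ℕ) < κ → (s : ℕ) < κ → r ≠ z → s ≠ z →
      g r s + g s r = Δ r s := by
    intro r s hrs hr hs hrz hsz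
    have hr' : ¬ κ ≤ (r : ℕ) := Nat.not_le.2 hr
    have hs' : ¬ κ ≤ (s : ℕ) := Nat.not_le.2 hs
    by_cases hrO : r ∈ O <;> by_cases hsO : s ∈ O
    · simp only [g, hrO, hsO, if_true]
      exact hpair r hrO s hsO hrs
    · simp only [g, h, hrO, hsO, if_true, if_false, hrz, hrs, hr', or_self]
      rw [hΔ s r, add_left_comm, zmod_two_add_self, add_zero]
    · simp only [g, h, hrO, hsO, if_true, if_false, hsz, hrs.symm, hs', or_self]
      rw [add_assoc, zmod_two_add_self, add_zero]
    · simp only [g, h, hrO, hsO, if_false, hrz, hsz, hrs, hrs.symm, hr', hs', or_self]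
      rcases lt_or_gt_of_ne hrs with hlt | hlt
      · simp [hlt, hlt.not_gt]
      · simp [hlt, hlt.not_gt, hΔ s r]
  by_cases hzero : ∀ r s, Δ r s = 0
  -- Without twists row `z` is forced to be column `z` of `g`. Its sum is that of all entries of `g`
  -- on the remaining rows, a symmetric matrix with zero diagonal, so the row is even.
  · let w : Fin P → ZMod 2 := fun s => if s = z ∨ κ ≤ s then 0 else g s z
    have hw : IsRow κ z w := by
      refine ⟨by simp [w], fun s hs => by simp [w, hs], ?_⟩
      let A : Finset (Fin P) := Finset.univ.filter fun s => s ≠ z ∧ (s : ℕ) < κ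
      have e₁ : ∑ s, w s = ∑ s ∈ A, g s z := by
        rw [Finset.sum_filter]
        refine Finset.sum_congr rfl fun s _ => ?_
        by_cases h₁ : s = z <;> by_cases h₂ : κ ≤ (s : ℕ) <;> simp [w, h₁, h₂]
      have e₂ : ∀ s ∈ A, g s z = ∑ s' ∈ A, g s s' := by
        intro s hs
        obtain ⟨-, hsz, hsκ⟩ := Finset.mem_filter.1 hs
        obtain ⟨-, hsupp, hsum⟩ := hg s hsz hsκ
        rw [← Finset.add_sum_erase _ _ (Finset.mem_univ z)] at hsum
        have e₃ : ∑ s' ∈ Finset.univ.erase z, g s s' = ∑ s' ∈ A, g s s' := by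
          symm
          refine Finset.sum_subset (fun s' hs' => ?_) fun s' h₁ h₂ => hsupp s' ?_
          · exact Finset.mem_erase.2 ⟨(Finset.mem_filter.1 hs').2.1, Finset.mem_univ _⟩
          · by_contra h₃
            exact h₂ (Finset.mem_filter.2 ⟨Finset.mem_univ _, Finset.ne_of_mem_erase h₁,
              Nat.not_le.1 h₃⟩)
        rw [e₃] at hsum
        have := congrArg (· + ∑ s' ∈ A, g s s') hsum
        simpa [add_assoc, zmod_two_add_self] using this
      rw [e₁, Finset.sum_congr rfl e₂]
      refine sum_symmetric_eq_zero A g (fun s hs => ?_) fun s hs s' hs' hne => ?_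
      · obtain ⟨-, hsz, hsκ⟩ := Finset.mem_filter.1 hs
        exact (hg s hsz hsκ).1
      · obtain ⟨-, hsz, hsκ⟩ := Finset.mem_filter.1 hs
        obtain ⟨-, hsz', hsκ'⟩ := Finset.mem_filter.1 hs'
        rw [hgpair s s' hne hsκ hsκ' hsz hsz', hzero]
    have hall : ∀ r s : Fin P, r ≠ s → (r : ℕ) < κ → (s : ℕ) < κ →
        Function.update g z w r s + Function.update g z w s r = Δ r s := by
      intro r s hrs hr hs
      by_cases hrz : r = z
      · subst hrz
        rw [Function.update_self, Function.update_of_ne hrs.symm, hzero]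
        simp only [w, hrs.symm, Nat.not_le.2 hs, or_self, if_false]
        exact zmod_two_add_self _
      · by_cases hsz : s = z
        · subst hsz
          rw [Function.update_self, Function.update_of_ne hrs, hzero]
          simp only [w, hrs, Nat.not_le.2 hr, or_self, if_false]
          exact zmod_two_add_self _
        · rw [Function.update_of_ne hrz, Function.update_of_ne hsz]
          exact hgpair r s hrs hr hs hrz hsz
    refine ⟨Function.update g z w, fun r hr => ?_, fun r hr => ?_,
      fun r s hrs hr hs _ _ => hall r s hrs hr hs, fun _ => hall⟩
    · rw [Function.update_of_ne (by rintro rfl; exact hz hr)]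
      exact funext fun s => by simp [g, hr]
    · by_cases hrz : r = z
      · subst hrz
        rwa [Function.update_self]
      · rw [Function.update_of_ne hrz]
        exact hg r hrz hr
  · refine ⟨Function.update g z 0, fun r hr => ?_, fun r hr => ?_,
      fun r s hrs hr hs hrz hsz => ?_, fun h => absurd h hzero⟩
    · rw [Function.update_of_ne (by rintro rfl; exact hz hr)]
      exact funext fun s => by simp [g, hr]
    · by_cases hrz : r = z
      · subst hrz
        rw [Function.update_self]
        exact IsRow.zero κ r
      · rw [Function.update_of_ne hrz]
        exact hg r hrz hr
    · rw [Function.update_of_ne hrz, Function.update_of_ne hsz]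
      exact hgpair r s hrs hr hs hrz hsz

/-- An inconsistency at the row `z` can be moved to another row `z'` by changing row `z` only. -/
theorem exists_row_switch {P κ : ℕ} (f Δ : Fin P → Fin P → ZMod 2) (z z' : Fin P)
    (hz' : (z' : ℕ) < κ) (hne : z' ≠ z) :
    ∃ w : Fin P → ZMod 2, IsRow κ z w ∧
      ∀ s : Fin P, s ≠ z → s ≠ z' → (s : ℕ) < κ → w s = Δ z s + f s z := by
  classical
  -- These are the entries forced by the other rows; overwriting the one at `z'` makes the sum even
  -- and leaves only the equation between `z` and `z'` open.
  let h : Fin P → ZMod 2 := fun s => if s = z ∨ κ ≤ s then 0 else Δ z s + f s z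
  refine ⟨Function.update h z' (∑ s ∈ Finset.univ.erase z', h s), ⟨?_, fun s hs => ?_, ?_⟩,
    fun s hsz hsz' hs => ?_⟩
  · rw [Function.update_of_ne hne.symm]
    simp [h]
  · rw [Function.update_of_ne (by rintro rfl; omega)]
    simp [h, hs]
  · rw [← Finset.add_sum_erase _ _ (Finset.mem_univ z'), Function.update_self]
    have e : ∀ c, ∑ s ∈ Finset.univ.erase z', Function.update h z' c s =
        ∑ s ∈ Finset.univ.erase z', h s := fun c =>
      Finset.sum_congr rfl fun s hs => Function.update_of_ne (Finset.ne_of_mem_erase hs) _ _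
    rw [e]
    exact zmod_two_add_self _
  · rw [Function.update_of_ne hsz']
    simp [h, hsz, Nat.not_le.2 hs]

/-! ### The duplicator hides the twists -/

namespace Skeleton

variable {roles rows : ℕ → ℕ} (S : Skeleton roles rows)

/-- A permutation `π` of the skeleton and switchings `f` of the gadgets that transform the graph
given by `b` into the one given by `b'`, except for edges at the row `z` of a gadget of level at
least `l`. -/
structure IsSwitching (b b' : S.B → S.B → ℕ → Prop) (l : ℕ) (π : Equiv.Perm S.B)
    (f : S.B → S.B → Fin S.bound → Fin S.bound → Fin S.bound → ZMod 2)
    (z : S.B → S.B → Fin S.bound → Fin S.bound) : Prop where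
  lev_eq : ∀ β, S.lev (π β) = S.lev β
  fix : ∀ β, S.lev β < l → π β = β
  row : ∀ x y t (r : Fin S.bound), S.lev x < S.lev y → (r : ℕ) < rows (S.lev y) →
    IsRow (rows (S.lev y)) r (f x y t r)
  pair : ∀ x y t (r s : Fin S.bound), S.lev x < S.lev y → r ≠ s → (r : ℕ) < rows (S.lev y) →
    (s : ℕ) < rows (S.lev y) → (S.lev y < l ∨ (r ≠ z x y t ∧ s ≠ z x y t)) →
    f x y t r s + f x y t s r = twist (b x y t) r s + twist (b' (π x) (π y) t) r s

/-- The vertex `w` is the image of the vertex `v`. -/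
def Moved (π : Equiv.Perm S.B)
    (f : S.B → S.B → Fin S.bound → Fin S.bound → Fin S.bound → ZMod 2) :
    S.Vertex → S.Vertex → Prop
  | .inl β, .inl γ => γ = π β
  | .inr v, .inr w => w.x = π v.x ∧ w.y = π v.y ∧ w.t = v.t ∧ w.r = v.r ∧
      w.u = v.u + f v.x v.y v.t v.r
  | _, _ => False

/-- The vertex does not lie in an exceptional row. -/
def Free (l : ℕ) (z : S.B → S.B → Fin S.bound → Fin S.bound) : S.Vertex → Prop
  | .inl _ => True
  | .inr v => l ≤ S.lev v.y → v.r ≠ z v.x v.y v.t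

variable {S}

theorem Moved.eq_iff {π : Equiv.Perm S.B}
    {f : S.B → S.B → Fin S.bound → Fin S.bound → Fin S.bound → ZMod 2} {v w v' w' : S.Vertex}
    (h : S.Moved π f v w) (h' : S.Moved π f v' w') : v = v' ↔ w = w' := by
  rcases v with β | v <;> rcases w with γ | w <;> try exact h.elim
  all_goals rcases v' with β' | v' <;> rcases w' with γ' | w' <;> try exact h'.elim
  · simp only [Moved] at h h'
    simp [h, h']
  · simp
  · simp
  · obtain ⟨h₁, h₂, h₃, h₄, h₅⟩ := h
    obtain ⟨h₁', h₂', h₃', h₄', h₅'⟩ := h'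
    simp only [Sum.inr.injEq]
    constructor
    · rintro rfl
      ext1 <;> simp_all
    · rintro rfl
      have e₁ : v.x = v'.x := π.injective (h₁.symm.trans h₁')
      have e₂ : v.y = v'.y := π.injective (h₂.symm.trans h₂')
      have e₃ : v.t = v'.t := h₃.symm.trans h₃'
      have e₄ : v.r = v'.r := h₄.symm.trans h₄'
      ext1
      · exact e₁
      · exact e₂
      · exact e₃
      · exact e₄
      · rw [e₁, e₂, e₃, e₄, h₅'] at h₅
        exact (add_right_cancel h₅).symm

theorem exists_equiv_moved {π : Equiv.Perm S.B} (hπ : ∀ β, S.lev (π β) = S.lev β)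
    {f : S.B → S.B → Fin S.bound → Fin S.bound → Fin S.bound → ZMod 2}
    (hf : ∀ x y t (r : Fin S.bound), S.lev x < S.lev y → (r : ℕ) < rows (S.lev y) →
      IsRow (rows (S.lev y)) r (f x y t r)) :
    ∃ σ : S.Vertex ≃ S.Vertex, ∀ v, S.Moved π f v (σ v) := by
  have h : ∀ v, ∃ w, S.Moved π f v w := by
    rintro (β | v)
    · exact ⟨.inl (π β), rfl⟩
    · refine ⟨.inr ⟨π v.x, π v.y, v.t, v.r, v.u + f v.x v.y v.t v.r, ?_, ?_, ?_, ?_⟩,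
        rfl, rfl, rfl, rfl, rfl⟩
      · rw [hπ, hπ]
        exact v.lev_lt
      · rw [hπ]
        exact v.t_lt
      · rw [hπ]
        exact v.r_lt
      · rw [hπ]
        exact v.row.add (hf _ _ _ _ v.lev_lt v.r_lt)
  choose σ hσ using h
  have inj : Function.Injective σ := fun v w e => ((hσ v).eq_iff (hσ w)).2 e
  exact ⟨Equiv.ofBijective σ (Finite.injective_iff_bijective.1 inj), hσ⟩

theorem zmod_two_cancel {A c d e : ZMod 2} (h : d = c + e) : A = c ↔ A + d = e := by
  revert A c d e; decide

/-- Between two rows of a gadget, the switchings change `v.u w.r + w.u v.r` by exactly the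
difference of the twists. All other edges depend on levels, labels and incidences only; `π` keeps
them because `0 < l` makes it fix the labels. -/
theorem Moved.adj_iff {b b' : S.B → S.B → ℕ → Prop} {l : ℕ} (hl : 0 < l) {π : Equiv.Perm S.B}
    {f : S.B → S.B → Fin S.bound → Fin S.bound → Fin S.bound → ZMod 2}
    {z : S.B → S.B → Fin S.bound → Fin S.bound} (hs : S.IsSwitching b b' l π f z)
    {v w v' w' : S.Vertex} (h : S.Moved π f v w) (h' : S.Moved π f v' w')
    (hv : S.Free l z v) (hv' : S.Free l z v') : S.Adj b v v' ↔ S.Adj b' w w' := by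
  have hlab : ∀ β, S.lev β = 0 → π β = β := fun β hβ => hs.fix β (hβ ▸ hl)
  rcases v with β | v <;> rcases w with γ | w <;> try exact h.elim
  all_goals rcases v' with β' | v' <;> rcases w' with γ' | w' <;> try exact h'.elim
  · simp only [Moved] at h h'
    subst h h'
    simp only [Adj, hs.lev_eq, π.injective.eq_iff]
    by_cases h₁ : S.lev β = 0 <;> by_cases h₂ : S.lev β' = 0 <;> simp [h₁, h₂, hlab]
  · simp only [Moved] at h h'
    subst h
    simp only [Adj, h'.1, π.injective.eq_iff]
  · simp only [Moved] at h h'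
    subst h'
    simp only [Adj, h.2.1, h.2.2.1, h.2.2.2.1, π.injective.eq_iff, hs.lev_eq]
    by_cases h₂ : S.lev β' = 0 <;> simp [h₂, hlab]
  · have heq := h.eq_iff h'
    simp only [Sum.inr.injEq] at heq
    obtain ⟨h₁, h₂, h₃, h₄, h₅⟩ := h
    obtain ⟨h₁', h₂', h₃', h₄', h₅'⟩ := h'
    simp only [Adj, heq]
    refine or_congr_right ?_
    rw [h₁, h₂, h₃, h₄, h₅, h₁', h₂', h₃', h₄', h₅', π.injective.eq_iff, π.injective.eq_iff]
    refine and_congr_right fun e₁ => and_congr_right fun e₂ => and_congr_right fun e₃ =>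
      and_congr_right fun hne => ?_
    have hp := hs.pair v.x v.y v.t v.r v'.r v.lev_lt hne v.r_lt (e₂ ▸ v'.r_lt) (by
      rcases Nat.lt_or_ge (S.lev v.y) l with hlt | hge
      · exact .inl hlt
      · refine .inr ⟨hv hge, ?_⟩
        rw [e₁, e₂, e₃]
        exact hv' (e₂ ▸ hge))
    rw [Pi.add_apply, Pi.add_apply, ← e₁, ← e₂, ← e₃, add_add_add_comm]
    exact zmod_two_cancel hp

variable (S)

/-- The positions from which the duplicator wins. -/
def positions (b b' : S.B → S.B → ℕ → Prop) (l : ℕ) : Set (Set (S.Vertex × S.Vertex)) :=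
  {s | ∃ π f z, S.IsSwitching b b' l π f z ∧ ∀ p ∈ s, S.Moved π f p.1 p.2 ∧ S.Free l z p.1}

variable {S}

/-- In each gadget from level `l` on, the exceptional row can be exchanged for one without pebbles
by switching the old exceptional row only. No pebble lies there, so the present position is not
disturbed. -/
theorem positions_extend {b b' : S.B → S.B → ℕ → Prop} {l k : ℕ}
    (hk : ∀ i, l ≤ i → i ≤ S.height → k < rows i) {s : Set (S.Vertex × S.Vertex)}
    (hs : s ∈ S.positions b b' l) (hcard : s.ncard < k) :
    ∃ σ : S.Vertex ≃ S.Vertex, ∀ v, insert (v, σ v) s ∈ S.positions b b' l := by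
  classical
  obtain ⟨π, f, z, hsw, hpos⟩ := hs
  have hz' : ∀ x y t, ∃ z' : Fin S.bound, l ≤ S.lev y → (z' : ℕ) < rows (S.lev y) ∧
      z' ≠ z x y t ∧ ∀ p ∈ s, ∀ v : S.GadgetVertex, p.1 = .inr v → v.r ≠ z' := by
    intro x y t
    by_cases hy : l ≤ S.lev y
    swap
    · exact ⟨z x y t, fun h => absurd h hy⟩
    let rowOf : S.Vertex × S.Vertex → Fin S.bound := fun p =>
      Sum.elim (fun _ => z x y t) GadgetVertex.r p.1
    -- The rows to be avoided are those of the fewer than `k` pebbled pairs and the row `z x y t`,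
    -- hence at most `k` rows.
    have hT : (insert (z x y t) (rowOf '' s)).ncard < rows (S.lev y) := by
      have h₁ := Set.ncard_insert_le (z x y t) (rowOf '' s)
      have h₂ := Set.ncard_image_le (f := rowOf) s.toFinite
      have h₃ := hk _ hy (S.levels.lev_le y)
      omega
    obtain ⟨r, hr, hrT⟩ := exists_row_notMem (S.rows_le _ (S.levels.lev_le y)) _ hT
    refine ⟨r, fun _ => ⟨hr, fun h => hrT (h ▸ Set.mem_insert _ _), ?_⟩⟩
    rintro p hp v hpv rfl
    refine hrT (Set.mem_insert_of_mem _ ⟨p, hp, ?_⟩)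
    simp [rowOf, hpv]
  choose z' hz' using hz'
  have hw : ∀ x y t, ∃ w : Fin S.bound → ZMod 2, l ≤ S.lev y →
      IsRow (rows (S.lev y)) (z x y t) w ∧ ∀ r : Fin S.bound, r ≠ z x y t → r ≠ z' x y t →
        (r : ℕ) < rows (S.lev y) → w r = (twist (b x y t) (z x y t) r +
          twist (b' (π x) (π y) t) (z x y t) r) + f x y t r (z x y t) := by
    intro x y t
    by_cases hy : l ≤ S.lev y
    · obtain ⟨w, hw⟩ := exists_row_switch (κ := rows (S.lev y)) (f x y t)
        (fun r s => twist (b x y t) r s + twist (b' (π x) (π y) t) r s) (z x y t) (z' x y t)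
        (hz' x y t hy).1 (hz' x y t hy).2.1
      exact ⟨w, fun _ => hw⟩
    · exact ⟨0, fun h => absurd h hy⟩
  choose w hw using hw
  let f' : S.B → S.B → Fin S.bound → Fin S.bound → Fin S.bound → ZMod 2 := fun x y t r =>
    if l ≤ S.lev y ∧ r = z x y t then w x y t else f x y t r
  have hf'z : ∀ x y t, l ≤ S.lev y → f' x y t (z x y t) = w x y t := fun x y t hy => by
    simp [f', hy]
  have hf'ne : ∀ x y t r, (l ≤ S.lev y → r ≠ z x y t) → f' x y t r = f x y t r :=
    fun x y t r h => if_neg fun h' => h h'.1 h'.2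
  have hsw' : S.IsSwitching b b' l π f' z' := by
    refine ⟨hsw.lev_eq, hsw.fix, fun x y t r hxy hr => ?_, fun x y t r r' hxy hne hr hr' hc => ?_⟩
    · by_cases h : l ≤ S.lev y ∧ r = z x y t
      · rw [h.2, hf'z _ _ _ h.1]
        exact (hw x y t h.1).1
      · rw [hf'ne _ _ _ _ fun h₁ h₂ => h ⟨h₁, h₂⟩]
        exact hsw.row x y t r hxy hr
    · rcases Nat.lt_or_ge (S.lev y) l with hy | hy
      · rw [hf'ne _ _ _ _ fun h => absurd h (Nat.not_le.2 hy),
          hf'ne _ _ _ _ fun h => absurd h (Nat.not_le.2 hy)]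
        exact hsw.pair x y t r r' hxy hne hr hr' (.inl hy)
      · obtain ⟨hrz, hrz'⟩ := hc.resolve_left (Nat.not_lt.2 hy)
        by_cases h₁ : r = z x y t
        · subst h₁
          rw [hf'z _ _ _ hy, hf'ne _ _ _ _ fun _ => hne.symm, (hw x y t hy).2 r' hne.symm hrz' hr',
            add_assoc, zmod_two_add_self, add_zero]
        · by_cases h₂ : r' = z x y t
          · subst h₂
            rw [hf'z _ _ _ hy, hf'ne _ _ _ _ fun _ => hne, (hw x y t hy).2 r hne hrz hr,
              add_left_comm, zmod_two_add_self, add_zero, twist_comm, twist_comm (b' _ _ _)]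
          · rw [hf'ne _ _ _ _ fun _ => h₁, hf'ne _ _ _ _ fun _ => h₂]
            exact hsw.pair x y t r r' hxy hne hr hr' (.inr ⟨h₁, h₂⟩)
  have hmoved : ∀ v v', S.Free l z v → (S.Moved π f' v v' ↔ S.Moved π f v v') := by
    rintro (β | v) (γ | w) hv <;> try exact Iff.rfl
    simp only [Moved, hf'ne _ _ _ _ hv]
  obtain ⟨σ, hσ⟩ := exists_equiv_moved hsw.lev_eq hsw'.row
  refine ⟨σ, fun v => ?_⟩
  -- The bijection `σ` uses `f'` throughout, as it must not depend on the chosen vertex. On free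
  -- vertices it agrees with `f`, so the old witnesses remain valid; on a vertex of an old
  -- exceptional row the new ones are taken.
  by_cases hv : S.Free l z v
  · refine ⟨π, f, z, hsw, ?_⟩
    rintro p (rfl | hp)
    · exact ⟨(hmoved _ _ hv).1 (hσ v), hv⟩
    · exact hpos p hp
  · refine ⟨π, f', z', hsw', ?_⟩
    rintro p (rfl | hp)
    · refine ⟨hσ v, ?_⟩
      rcases v with β | v
      · trivial
      · intro hy
        have : v.r = z v.x v.y v.t := by
          by_contra h
          exact hv fun _ => h
        rw [this]
        exact (hz' _ _ _ hy).2.1.symm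
    · refine ⟨(hmoved _ _ (hpos p hp).2).2 (hpos p hp).1, ?_⟩
      rcases hp1 : p.1 with β | v
      · trivial
      · exact fun hy => (hz' _ _ _ hy).2.2 p hp v hp1

theorem isBijectiveSystem_positions (b b' : S.B → S.B → ℕ → Prop) {l k : ℕ} (hl : 0 < l)
    (hk : ∀ i, l ≤ i → i ≤ S.height → k < rows i) :
    IsBijectiveSystem (S.graph b) (S.graph b') k (S.positions b b' l) where
  eq_iff := by
    rintro s ⟨π, f, z, -, h⟩ p hp p' hp'
    exact (h p hp).1.eq_iff (h p' hp').1
  adj_iff := by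
    rintro s ⟨π, f, z, hsw, h⟩ p hp p' hp'
    exact (h p hp).1.adj_iff hl hsw (h p' hp').1 (h p hp).2 (h p' hp').2
  mono := by
    rintro s ⟨π, f, z, hsw, h⟩ t ht
    exact ⟨π, f, z, hsw, fun p hp => h p (ht hp)⟩
  extend := fun s hs hcard => positions_extend hk hs hcard

/-! ### Tuples with the same information -/

theorem adj_gadget_iff {b : S.B → S.B → ℕ → Prop} {v w : S.GadgetVertex} (hx : v.x = w.x)
    (hy : v.y = w.y) (ht : v.t = w.t) (hr : v.r ≠ w.r) :
    S.Adj b (.inr v) (.inr w) ↔ v.u w.r + w.u v.r = twist (b v.x v.y v.t) v.r w.r := by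
  have : v ≠ w := fun h => hr (congrArg _ h)
  simp [Adj, hx, hy, ht, hr, this]

/-- The zero vector in row `s` sees `v` and `w` only through their coordinates `s`. Conversely, a
vertex of that role and row that separates `v` from `w` must lie in the same gadget, and its own
vector contributes the same summand to both equations. -/
theorem testBit_diff_gadget {b : S.B → S.B → ℕ → Prop} {v w : S.GadgetVertex} (hx : v.x = w.x)
    (hy : v.y = w.y) (ht : v.t = w.t) (hr : v.r = w.r) {s : Fin S.bound} (hs : s ≠ v.r)
    (hsκ : (s : ℕ) < rows (S.lev v.y)) :
    (S.diff b (.inr v) (.inr w)).testBit (Nat.pair v.t s) = true ↔ v.u s ≠ w.u s := by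
  rw [testBit_diff]
  have key : ∀ c d e f : ZMod 2, ¬ (c + d = e ↔ c + f = e) ↔ d ≠ f := by decide
  constructor
  · rintro ⟨z, hz, hadj⟩
    obtain ⟨hzt, hzr⟩ := Nat.pair_eq_pair.1 hz
    have hzr : z.r = s := Fin.ext hzr
    have hzt : z.t = v.t := Fin.ext hzt
    have hzv : z.r ≠ v.r := hzr ▸ hs
    have hzw : z.r ≠ w.r := hr ▸ hzv
    by_cases h : z.x = v.x ∧ z.y = v.y
    · rw [adj_gadget_iff h.1 h.2 hzt hzv, adj_gadget_iff (h.1.trans hx) (h.2.trans hy)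
        (hzt.trans ht) hzw, ← hr, key, hzr] at hadj
      exact hadj
    · refine absurd ?_ hadj
      have h₁ : ¬ S.Adj b (.inr z) (.inr v) := by
        rintro (rfl | h')
        exacts [hzv rfl, h ⟨h'.1, h'.2.1⟩]
      have h₂ : ¬ S.Adj b (.inr z) (.inr w) := by
        rintro (rfl | h')
        exacts [hzw rfl, h ⟨h'.1.trans hx.symm, h'.2.1.trans hy.symm⟩]
      exact iff_of_false h₁ h₂
  · intro hne
    let z : S.GadgetVertex := ⟨v.x, v.y, v.t, s, 0, v.lev_lt, v.t_lt, hsκ, IsRow.zero _ _⟩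
    refine ⟨z, rfl, ?_⟩
    rw [adj_gadget_iff (v := z) (w := v) rfl rfl rfl hs,
      adj_gadget_iff (v := z) (w := w) hx hy ht (hr ▸ hs), ← hr, key]
    exact hne

/-- The coordinates 0 and 1 coincide exactly for the points of the skeleton: in a gadget `x` has a
lower level than `y`. -/
theorem SameInfo.inl {b b' : S.B → S.B → ℕ → Prop} {l m : ℕ} {a a' : Fin m → S.Vertex}
    (h : S.SameInfo b b' l a a') {i : Fin m} {β : S.B} (hi : a i = .inl β) :
    ∃ γ, a' i = .inl γ := by
  rcases hi' : a' i with γ | w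
  · exact ⟨γ, rfl⟩
  · have h₁ := (h.eq_iff i 0 i 1).1 (by simp [hi, coord])
    rw [hi'] at h₁
    have h₂ := w.lev_lt
    have h₃ : w.x = w.y := h₁
    rw [h₃] at h₂
    exact absurd h₂ (lt_irrefl _)

theorem SameInfo.symm {b b' : S.B → S.B → ℕ → Prop} {l m : ℕ} {a a' : Fin m → S.Vertex}
    (h : S.SameInfo b b' l a a') : S.SameInfo b' b l a' a where
  lev_eq := fun s c => (h.lev_eq s c).symm
  low_eq := fun s c hs => (h.low_eq s c ((h.lev_eq s c).symm ▸ hs)).symm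
  eq_iff := fun s c s' c' => (h.eq_iff s c s' c').symm
  adj_iff := fun s s' => (h.adj_iff s s').symm
  diff_eq := fun s s' => (h.diff_eq s s').symm

theorem SameInfo.inr {b b' : S.B → S.B → ℕ → Prop} {l m : ℕ} {a a' : Fin m → S.Vertex}
    (h : S.SameInfo b b' l a a') {i : Fin m} {v : S.GadgetVertex} (hi : a i = .inr v) :
    ∃ w, a' i = .inr w := by
  rcases hi' : a' i with γ | w
  · obtain ⟨β, hβ⟩ := h.symm.inl hi'
    rw [hi] at hβ
    cases hβ
  · exact ⟨w, rfl⟩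

theorem zmod_two_add_eq_of_iff {A c A' c' : ZMod 2} (h : A = c ↔ A' = c') : A + A' = c + c' := by
  revert A c A' c'; decide

/-- Tuples with the same information form a winning position. -/
theorem SameInfo.mem_positions {b b' : S.B → S.B → ℕ → Prop} {l m : ℕ} (hl : 0 < l)
    (hb : ∀ x y t, S.lev y < l → (b x y t ↔ b' x y t))
    (hm : ∀ i, l ≤ i → i ≤ S.height → m < rows i) {a a' : Fin m → S.Vertex}
    (h : S.SameInfo b b' l a a') : tuplePairs a a' ∈ S.positions b b' l := by
  classical
  obtain ⟨π, hπlev, hπfix, hπ⟩ := exists_perm_extend S.lev l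
    (fun i : Fin m × Fin 3 => S.coord (a i.1) i.2) (fun i => S.coord (a' i.1) i.2)
    (fun i => h.lev_eq i.1 i.2) (fun i => h.low_eq i.1 i.2)
    (fun i j => h.eq_iff i.1 i.2 j.1 j.2)
  have hgad : ∀ i v w, a i = .inr v → a' i = .inr w →
      w.x = π v.x ∧ w.y = π v.y ∧ w.t = v.t ∧ w.r = v.r := by
    intro i v w hi hi'
    have hx := hπ (i, 0)
    have hy := hπ (i, 1)
    have hρ := h.low_eq i 2
    simp only [hi, hi', coord] at hx hy hρ
    have hρ := S.lab_inj (v.pair_lt.trans S.pow_bits_gt) (w.pair_lt.trans S.pow_bits_gt)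
      (hρ ((S.levels.lev_lab _).trans_lt hl))
    obtain ⟨h₁, h₂⟩ := Nat.pair_eq_pair.1 hρ
    exact ⟨hx.symm, hy.symm, (Fin.ext h₁).symm, (Fin.ext h₂).symm⟩
  -- All pebbled vertices of one row have to be switched by the same vector. It is well defined
  -- because `diff` records the coordinates in which two vertices of a row differ.
  have hu : ∀ i j v v' w w', a i = .inr v → a' i = .inr v' → a j = .inr w → a' j = .inr w' →
      v.x = w.x → v.y = w.y → v.t = w.t → v.r = w.r → v'.u + v.u = w'.u + w.u := by
    intro i j v v' w w' hi hi' hj hj' hx hy ht hr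
    obtain ⟨h₁, h₂, h₃, h₄⟩ := hgad i v v' hi hi'
    obtain ⟨g₁, g₂, g₃, g₄⟩ := hgad j w w' hj hj'
    have hlev : S.lev v'.y = S.lev v.y := by rw [h₂, hπlev]
    funext s
    simp only [Pi.add_apply]
    by_cases hs : s = v.r
    · have e₁ : v.u s = 0 := hs ▸ v.row.1
      have e₂ : w.u s = 0 := by rw [hs, hr]; exact w.row.1
      have e₃ : v'.u s = 0 := by rw [hs, ← h₄]; exact v'.row.1
      have e₄ : w'.u s = 0 := by rw [hs, hr, ← g₄]; exact w'.row.1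
      rw [e₁, e₂, e₃, e₄]
    · by_cases hκ : (s : ℕ) < rows (S.lev v.y)
      · have hd := h.diff_eq i j
        rw [hi, hi', hj, hj'] at hd
        have e₁ := testBit_diff_gadget (b := b) hx hy ht hr hs hκ
        have e₂ := testBit_diff_gadget (b := b') (v := v') (w := w') (by rw [h₁, g₁, hx])
          (by rw [h₂, g₂, hy]) (by rw [h₃, g₃, ht]) (by rw [h₄, g₄, hr]) (s := s)
          (by rwa [h₄]) (by rwa [hlev])
        rw [hd, ← h₃] at e₁
        have e₃ := e₁.symm.trans e₂
        generalize v.u s = A, w.u s = B, v'.u s = C, w'.u s = D at e₃ ⊢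
        revert A B C D
        decide
      · have hκ := Nat.not_lt.1 hκ
        rw [v.row.2.1 s hκ, w.row.2.1 s (hy ▸ hκ), v'.row.2.1 s (hlev.symm ▸ hκ),
          w'.row.2.1 s (by rw [g₂, hπlev, ← hy]; exact hκ)]
  -- The rows of a gadget that the tuple meets; there the switching is prescribed.
  let occ : S.B → S.B → Fin S.bound → Set (Fin S.bound) := fun x y t =>
    {r | ∃ i v, a i = .inr v ∧ v.x = x ∧ v.y = y ∧ v.t = t ∧ v.r = r}
  have hf₀ : ∀ x y t r, ∃ g : Fin S.bound → ZMod 2, ∀ i v w, a i = .inr v → a' i = .inr w →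
      v.x = x → v.y = y → v.t = t → v.r = r → w.u = v.u + g := by
    intro x y t r
    by_cases hr : r ∈ occ x y t
    · obtain ⟨i, v, hi, hx, hy, ht, hr⟩ := hr
      obtain ⟨w, hi'⟩ := h.inr hi
      refine ⟨w.u + v.u, fun j v' w' hj hj' hx' hy' ht' hr' => ?_⟩
      rw [hu i j v w v' w' hi hi' hj hj' (hx.trans hx'.symm) (hy.trans hy'.symm)
        (ht.trans ht'.symm) (hr.trans hr'.symm)]
      funext s
      simp only [Pi.add_apply]
      rw [add_left_comm, zmod_two_add_self, add_zero]
    · exact ⟨0, fun i v w hi _ hx hy ht hr' => absurd ⟨i, v, hi, hx, hy, ht, hr'⟩ hr⟩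
  choose f₀ hf₀ using hf₀
  have hflip : ∀ i v w, a i = .inr v → a' i = .inr w →
      f₀ v.x v.y v.t v.r = v.u + w.u := by
    intro i v w hi hi'
    rw [hf₀ _ _ _ _ i v w hi hi' rfl rfl rfl rfl]
    funext s
    simp only [Pi.add_apply]
    rw [← add_assoc, zmod_two_add_self, zero_add]
  have hrow₀ : ∀ x y t, ∀ r ∈ occ x y t, IsRow (rows (S.lev y)) r (f₀ x y t r) := by
    rintro x y t r ⟨i, v, hi, rfl, rfl, rfl, rfl⟩
    obtain ⟨w, hi'⟩ := h.inr hi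
    obtain ⟨-, h₂, -, h₄⟩ := hgad i v w hi hi'
    rw [hflip i v w hi hi']
    have := w.row
    rw [h₂, hπlev, h₄] at this
    exact v.row.add this
  have hpair₀ : ∀ x y t, ∀ r ∈ occ x y t, ∀ s ∈ occ x y t, r ≠ s →
      f₀ x y t r s + f₀ x y t s r = twist (b x y t) r s + twist (b' (π x) (π y) t) r s := by
    rintro x y t r ⟨i, v, hi, rfl, rfl, rfl, rfl⟩ s ⟨j, w, hj, hx, hy, ht, rfl⟩ hne
    obtain ⟨v', hi'⟩ := h.inr hi
    obtain ⟨w', hj'⟩ := h.inr hj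
    obtain ⟨h₁, h₂, h₃, h₄⟩ := hgad i v v' hi hi'
    obtain ⟨g₁, g₂, g₃, g₄⟩ := hgad j w w' hj hj'
    have hadj := h.adj_iff i j
    rw [hi, hi', hj, hj', adj_gadget_iff hx.symm hy.symm ht.symm hne,
      adj_gadget_iff (by rw [h₁, g₁, hx]) (by rw [h₂, g₂, hy]) (by rw [h₃, g₃, ht])
        (by rwa [h₄, g₄]), h₁, h₂, h₃, h₄, g₄] at hadj
    have e₁ := hflip i v v' hi hi'
    have e₂ := hflip j w w' hj hj'
    rw [hx, hy, ht] at e₂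
    rw [e₁, e₂, Pi.add_apply, Pi.add_apply, add_add_add_comm]
    exact zmod_two_add_eq_of_iff hadj
  have hcomplete : ∀ x y t, ∃ (f : Fin S.bound → Fin S.bound → ZMod 2) (z : Fin S.bound),
      S.lev x < S.lev y → (∀ r ∈ occ x y t, f r = f₀ x y t r) ∧
        (∀ r : Fin S.bound, (r : ℕ) < rows (S.lev y) → IsRow (rows (S.lev y)) r (f r)) ∧
        (∀ r s : Fin S.bound, r ≠ s → (r : ℕ) < rows (S.lev y) → (s : ℕ) < rows (S.lev y) →
          (S.lev y < l ∨ (r ≠ z ∧ s ≠ z)) →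
            f r s + f s r = twist (b x y t) r s + twist (b' (π x) (π y) t) r s) ∧
        (l ≤ S.lev y → z ∉ occ x y t) := by
    intro x y t
    by_cases hxy : S.lev x < S.lev y
    swap
    · exact ⟨0, t, fun h => absurd h hxy⟩
    -- A gadget with an unoccupied row has room for an inconsistency. If all rows are occupied, `f₀`
    -- already is a complete switching; this cannot happen from level `l` on, where there are more
    -- rows than entries of the tuple.
    by_cases hz : ∃ z : Fin S.bound, (z : ℕ) < rows (S.lev y) ∧ z ∉ occ x y t
    · obtain ⟨z, hzκ, hz⟩ := hz
      obtain ⟨f, hf₁, hf₂, hf₃, hf₄⟩ := exists_rows_extend (κ := rows (S.lev y)) (occ x y t)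
        (f₀ x y t) (fun r s => twist (b x y t) r s + twist (b' (π x) (π y) t) r s)
        (fun r s => by rw [twist_comm, twist_comm (b' _ _ _)]) (hrow₀ x y t) (hpair₀ x y t) z hz hzκ
      refine ⟨f, z, fun _ => ⟨hf₁, hf₂, fun r s hrs hr hs hc => ?_, fun _ => hz⟩⟩
      rcases hc with hy | hc
      -- Below level `l` the permutation fixes both points and the twists agree, so nothing has to
      -- be switched and no exceptional row arises.
      · refine hf₄ (fun r s => ?_) r s hrs hr hs
        rw [hπfix y hy, hπfix x (hxy.trans hy), propext (hb x y t hy)]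
        exact zmod_two_add_self _
      · exact hf₃ r s hrs hr hs hc.1 hc.2
    · push Not at hz
      refine ⟨f₀ x y t, t, fun _ => ⟨fun _ _ => rfl, fun r hr => hrow₀ x y t r (hz r hr),
        fun r s hrs hr hs _ => hpair₀ x y t r (hz r hr) s (hz s hs) hrs, fun hy => ?_⟩⟩
      exfalso
      let rowOf : Fin m → Fin S.bound := fun i => Sum.elim (fun _ => t) GadgetVertex.r (a i)
      have hT : (Set.range rowOf).ncard < rows (S.lev y) := by
        have := Set.ncard_image_le (f := rowOf) (s := Set.univ) Set.finite_univ
        rw [Set.image_univ, Set.ncard_univ, Nat.card_fin] at this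
        exact this.trans_lt (hm _ hy (S.levels.lev_le y))
      obtain ⟨r, hr, hrT⟩ := exists_row_notMem (S.rows_le _ (S.levels.lev_le y)) _ hT
      obtain ⟨i, v, hi, -, -, -, rfl⟩ := hz r hr
      exact hrT ⟨i, by simp [rowOf, hi]⟩
  choose f z hfz using hcomplete
  refine ⟨π, f, z, ⟨hπlev, hπfix, fun x y t r hxy hr => (hfz x y t hxy).2.1 r hr,
    fun x y t r s hxy hrs hr hs hc => (hfz x y t hxy).2.2.1 r s hrs hr hs hc⟩, ?_⟩
  rintro _ ⟨i, rfl⟩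
  rcases hi : a i with β | v
  · obtain ⟨γ, hγ⟩ := h.inl hi
    have := hπ (i, 0)
    simp only [hi, hγ, coord] at this
    simp only [hγ, hi]
    exact ⟨this.symm, trivial⟩
  · obtain ⟨w, hw⟩ := h.inr hi
    obtain ⟨h₁, h₂, h₃, h₄⟩ := hgad i v w hi hw
    have hocc : v.r ∈ occ v.x v.y v.t := ⟨i, v, hi, rfl, rfl, rfl, rfl⟩
    obtain ⟨c₁, -, -, c₄⟩ := hfz v.x v.y v.t v.lev_lt
    simp only [hw, hi]
    refine ⟨⟨h₁, h₂, h₃, h₄, ?_⟩, fun hy hr => c₄ hy (hr ▸ hocc)⟩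
    rw [c₁ _ hocc]
    exact hf₀ _ _ _ _ i v w hi hw rfl rfl rfl rfl

/-- This makes the truth tables well defined: the answer does not depend on the tuple or on the
twists from level `l` on. -/
theorem rel_iff_of_info_eq (q : PebbleQuery) {b b' : S.B → S.B → ℕ → Prop} {l : ℕ} (hl : 0 < l)
    (hq : ∀ i, l ≤ i → i ≤ S.height → q.arity < rows i ∧ q.width < rows i)
    (hb : ∀ x y t, S.lev y < l → (b x y t ↔ b' x y t)) {a a' : Fin q.arity → S.Vertex}
    (h : S.info b l a = S.info b' l a') : q.rel (S.graph b) a ↔ q.rel (S.graph b') a' :=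
  q.invariant (S.graph b) (S.graph b') _
    (isBijectiveSystem_positions b b' hl fun i h₁ h₂ => (hq i h₁ h₂).2) a a'
    ((S.sameInfo_of_info_eq h).mem_positions hl hb fun i h₁ h₂ => (hq i h₁ h₂).1)

end Skeleton

/-! ### First-order properties of the graphs -/

namespace Skeleton

variable {roles rows : ℕ → ℕ} (S : Skeleton roles rows)

/-- The vertex is a label. -/
def IsLabel (v : S.Vertex) : Prop := ∃ β, v = .inl β ∧ S.lev β = 0

/-- The vertex is a point of positive level. -/
def IsPoint (v : S.Vertex) : Prop := ∃ β, v = .inl β ∧ S.lev β ≠ 0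

/-- The vertex belongs to a gadget. -/
def IsGadget (v : S.Vertex) : Prop := ∃ g, v = .inr g

/-- The vertex `w` is the label of the level of the point `v`. -/
def IsLevelOf (v w : S.Vertex) : Prop := ∃ β, v = .inl β ∧ w = .inl (S.lab (S.lev β))

variable {S}

@[simp] theorem isLabel_inl {β : S.B} : S.IsLabel (.inl β) ↔ S.lev β = 0 := by
  simp [IsLabel]

@[simp] theorem isLabel_inr {g : S.GadgetVertex} : ¬ S.IsLabel (.inr g) := by
  simp [IsLabel]

@[simp] theorem isPoint_inl {β : S.B} : S.IsPoint (.inl β) ↔ S.lev β ≠ 0 := by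
  simp [IsPoint]

@[simp] theorem isPoint_inr {g : S.GadgetVertex} : ¬ S.IsPoint (.inr g) := by
  simp [IsPoint]

@[simp] theorem isGadget_inl {β : S.B} : ¬ S.IsGadget (.inl β) := by
  simp [IsGadget]

@[simp] theorem isGadget_inr {g : S.GadgetVertex} : S.IsGadget (.inr g) := by
  simp [IsGadget]

theorem adj_label_label (b : S.B → S.B → ℕ → Prop) {β γ : S.B} (hβ : S.lev β = 0)
    (hγ : S.lev γ = 0) :
    S.Adj b (.inl β) (.inl γ) ↔ (S.num γ).testBit (S.num β) = true := by
  simp [Adj, hβ, hγ]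

/-- Since `s < 2 ^ s`, no number has itself as the position of a binary digit 1, so labels carry no
loop; all other vertices do. -/
theorem adj_self_iff (b : S.B → S.B → ℕ → Prop) (v : S.Vertex) :
    S.Adj b v v ↔ ¬ S.IsLabel v := by
  rcases v with β | g
  · by_cases hβ : S.lev β = 0
    · rw [adj_label_label b hβ hβ, Nat.testBit_lt_two_pow Nat.lt_two_pow_self]
      simp [hβ]
    · simp [Adj, hβ]
  · simp [Adj]

theorem GadgetVertex.lev_y_ne {g : S.GadgetVertex} : S.lev g.y ≠ 0 :=
  Nat.ne_zero_of_lt g.lev_lt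

theorem adj_gadget_label (b : S.B → S.B → ℕ → Prop) {g : S.GadgetVertex} {β : S.B}
    (hβ : S.lev β = 0) :
    S.Adj b (.inr g) (.inl β) ↔ S.num β = Nat.pair g.t g.r := by
  simp only [Adj, hβ, true_and]
  refine or_iff_right ?_
  rintro rfl
  exact g.lev_y_ne hβ

/-- A point of positive level has edges only to itself and to gadget vertices, whereas every gadget
vertex has an edge to the loopless label that names its role and row. -/
theorem isPoint_iff (b : S.B → S.B → ℕ → Prop) (v : S.Vertex) :
    S.IsPoint v ↔ S.Adj b v v ∧ ∀ w, S.Adj b v w → S.Adj b w w := by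
  simp only [adj_self_iff]
  rcases v with β | g
  · simp only [isPoint_inl, isLabel_inl]
    constructor
    · intro h
      refine ⟨h, ?_⟩
      rintro (γ | g') hadj
      · simp only [Adj, h, false_and, false_or, not_false_eq_true, true_and, ne_eq] at hadj
        subst hadj
        simpa using h
      · simp
    · exact fun h => h.1
  · simp only [isPoint_inr, isLabel_inr, not_false_eq_true, true_and, false_iff, not_forall,
      not_not]
    refine ⟨.inl (S.lab (Nat.pair g.t g.r)), ?_, by simpa using S.levels.lev_lab _⟩
    rw [adj_gadget_label b (S.levels.lev_lab _)]
    exact S.num_lab g.pair_lt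

theorem isGadget_iff (b : S.B → S.B → ℕ → Prop) (v : S.Vertex) :
    S.IsGadget v ↔ S.Adj b v v ∧ ¬ S.IsPoint v := by
  rw [adj_self_iff]
  rcases v with β | g <;> simp

theorem eq_lab_iff {β : S.B} (hβ : S.lev β = 0) {s : ℕ} (hs : s < 2 ^ S.bits) :
    β = S.lab s ↔ S.num β = s := by
  constructor
  · rintro rfl
    exact S.levels.num_lab s hs
  · rintro rfl
    exact (S.levels.lab_num β hβ).symm

/-- The direction of the edges separates the coordinates of a gadget vertex: `x` is its only
in-neighbour in the skeleton, while `y` and the label of its role and row are its out-neighbours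
there. -/
theorem isCoord_zero_iff (b : S.B → S.B → ℕ → Prop) (v w : S.Vertex) :
    w = .inl (S.coord v 0) ↔ (¬ S.IsGadget v ∧ w = v) ∨
      (S.IsGadget v ∧ ¬ S.IsGadget w ∧ S.Adj b w v) := by
  rcases v with β | g
  · simp [coord]
  · rcases w with γ | g' <;> simp [coord, Adj]

theorem isCoord_one_iff (b : S.B → S.B → ℕ → Prop) (v w : S.Vertex) :
    w = .inl (S.coord v 1) ↔ (¬ S.IsGadget v ∧ w = v) ∨
      (S.IsGadget v ∧ S.IsPoint w ∧ S.Adj b v w) := by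
  rcases v with β | g
  · simp [coord]
  · rcases w with γ | g'
    · simp only [coord, Matrix.cons_val_one, Matrix.cons_val_zero, Sum.inl.injEq, isGadget_inr,
        not_true_eq_false, false_and, isPoint_inl, true_and, false_or]
      constructor
      · rintro rfl
        exact ⟨g.lev_y_ne, .inl rfl⟩
      · rintro ⟨h, h' | h'⟩
        exacts [h', absurd h'.1 h]
    · simp

theorem isCoord_two_iff (b : S.B → S.B → ℕ → Prop) (v w : S.Vertex) :
    w = .inl (S.coord v 2) ↔ (¬ S.IsGadget v ∧ w = v) ∨
      (S.IsGadget v ∧ S.IsLabel w ∧ S.Adj b v w) := by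
  rcases v with β | g
  · simp [coord]
  · rcases w with γ | g'
    · simp only [coord, Matrix.cons_val, Sum.inl.injEq, isGadget_inr,
        not_true_eq_false, false_and, isLabel_inl, true_and, false_or]
      constructor
      · rintro rfl
        refine ⟨S.levels.lev_lab _, ?_⟩
        rw [adj_gadget_label b (S.levels.lev_lab _)]
        exact S.num_lab g.pair_lt
      · rintro ⟨h, h'⟩
        rw [adj_gadget_label b h] at h'
        exact (eq_lab_iff h (g.pair_lt.trans S.pow_bits_gt)).2 h'
    · simp

theorem isLevelOf_iff (b : S.B → S.B → ℕ → Prop) (v w : S.Vertex) :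
    S.IsLevelOf v w ↔ (S.IsLabel v ∧ w = .inl (S.lab 0)) ∨
      (S.IsPoint v ∧ S.IsLabel w ∧ S.Adj b w v) := by
  rcases v with β | g
  · simp only [IsLevelOf, Sum.inl.injEq, exists_eq_left', isLabel_inl, isPoint_inl]
    by_cases hβ : S.lev β = 0
    · simp [hβ]
    · rcases w with γ | g'
      · simp only [hβ, false_and, ne_eq, not_false_eq_true, true_and, false_or, isLabel_inl,
          Sum.inl.injEq]
        constructor
        · rintro rfl
          refine ⟨S.levels.lev_lab _, .inr (.inl ⟨S.levels.lev_lab _, hβ, ?_⟩)⟩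
          exact S.levels.num_lab _ (S.lev_lt_pow β)
        · rintro ⟨h, h'⟩
          simp only [Adj, h, hβ, false_and, and_false, true_and, not_true_eq_false, false_or,
            or_false, not_false_eq_true, ne_eq] at h'
          exact (eq_lab_iff h (S.lev_lt_pow β)).2 h'
      · simp [hβ]
  · simp [IsLevelOf]

theorem testBit_eq_false_of_bits_le {d s : ℕ} (hd : d < 2 ^ S.bits) (hs : 2 ^ S.bits ≤ s) :
    d.testBit s = false :=
  Nat.testBit_lt_two_pow (hd.trans_le (hs.trans Nat.lt_two_pow_self.le))

/-- A label is determined by the labels of its binary digits. -/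
theorem eq_lab_iff_adj (b : S.B → S.B → ℕ → Prop) {d : ℕ} (hd : d < 2 ^ S.bits) (w : S.Vertex) :
    w = .inl (S.lab d) ↔ S.IsLabel w ∧ ∀ v, S.IsLabel v →
      (S.Adj b v w ↔ ∃ s, d.testBit s = true ∧ v = .inl (S.lab s)) := by
  have key : ∀ γ, S.lev γ = 0 → ((∃ s, d.testBit s = true ∧
      (.inl γ : S.Vertex) = .inl (S.lab s)) ↔ d.testBit (S.num γ) = true) := by
    intro γ hγ
    constructor
    · rintro ⟨s, hs, hγs⟩
      rcases Nat.lt_or_ge s (2 ^ S.bits) with h | h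
      · rwa [(eq_lab_iff hγ h).1 (Sum.inl.inj hγs)]
      · rw [testBit_eq_false_of_bits_le hd h] at hs
        cases hs
    · intro h
      exact ⟨_, h, congrArg _ (S.levels.lab_num γ hγ).symm⟩
  constructor
  · rintro rfl
    refine ⟨by simpa using S.levels.lev_lab _, ?_⟩
    rintro (γ | g) hv
    · rw [isLabel_inl] at hv
      rw [adj_label_label b hv (S.levels.lev_lab _), key γ hv]
      rw [show S.num (S.levels.lab d) = d from S.levels.num_lab d hd]
    · exact absurd hv isLabel_inr
  · rintro ⟨hw, h⟩
    rcases w with β | g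
    swap
    · exact absurd hw isLabel_inr
    rw [isLabel_inl] at hw
    refine congrArg _ ((eq_lab_iff hw hd).2 (Nat.eq_of_testBit_eq fun s => ?_))
    rcases Nat.lt_or_ge s (2 ^ S.bits) with hs | hs
    · have := h (.inl (S.lab s)) (by simpa using S.levels.lev_lab _)
      rw [adj_label_label b (S.levels.lev_lab _) hw, key _ (S.levels.lev_lab _)] at this
      rw [show S.num (S.lab s) = s from S.levels.num_lab s hs] at this
      exact Bool.eq_iff_iff.2 this
    · rw [testBit_eq_false_of_bits_le hd hs, testBit_eq_false_of_bits_le (S.levels.num_lt β hw) hs]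

theorem eq_lab_diff_iff (b : S.B → S.B → ℕ → Prop) (u v w : S.Vertex) :
    w = .inl (S.lab (S.diff b u v)) ↔ S.IsLabel w ∧ ∀ s, S.IsLabel s →
      (S.Adj b s w ↔ ∃ z, S.IsGadget z ∧ S.Adj b z s ∧ ¬ (S.Adj b z u ↔ S.Adj b z v)) := by
  rw [eq_lab_iff_adj b (S.diff_lt b u v)]
  refine and_congr_right fun _ => forall_congr' fun s => forall_congr' fun hs => ?_
  obtain ⟨γ, rfl, hγ⟩ := hs
  refine iff_congr Iff.rfl ?_
  simp only [testBit_diff]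
  constructor
  · rintro ⟨_, ⟨z, rfl, hz⟩, hγz⟩
    refine ⟨.inr z, isGadget_inr, ?_, hz⟩
    rw [adj_gadget_label b hγ]
    exact (eq_lab_iff hγ (z.pair_lt.trans S.pow_bits_gt)).1 (Sum.inl.inj hγz)
  · rintro ⟨_, ⟨z, rfl⟩, hzγ, hz⟩
    rw [adj_gadget_label b hγ] at hzγ
    exact ⟨_, ⟨z, rfl, hz⟩, congrArg _
      ((eq_lab_iff hγ (z.pair_lt.trans S.pow_bits_gt)).2 hzγ)⟩

/-- A gadget is untwisted if and only if it contains a clique with one vertex in every row. -/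
theorem not_twisted_iff (b : S.B → S.B → ℕ → Prop) {β γ : S.B} {l t : ℕ} (hβ : S.lev β < l)
    (hγ : S.lev γ = l) (ht : t < roles l) (hrows : 2 ≤ rows l) :
    ¬ b β γ t ↔ ∃ z : Fin (rows l) → S.Vertex, (∀ r, S.IsGadget (z r) ∧
      S.coord (z r) 0 = β ∧ S.coord (z r) 1 = γ ∧ S.coord (z r) 2 = S.lab (Nat.pair t r)) ∧
      ∀ r s, r ≠ s → S.Adj b (z r) (z s) := by
  classical
  subst hγ
  have hP := S.rows_le _ (S.levels.lev_le γ)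
  have htP : t < S.bound := ht.trans_le (S.roles_le _ (S.levels.lev_le γ))
  constructor
  · intro hb
    refine ⟨fun r => .inr ⟨β, γ, ⟨t, htP⟩, r.castLE hP, 0, hβ, ht, r.2, IsRow.zero _ _⟩,
      fun r => ⟨isGadget_inr, rfl, rfl, rfl⟩, fun r s hrs => ?_⟩
    refine .inr ⟨rfl, rfl, rfl, fun h => hrs (Fin.castLE_injective hP h), ?_⟩
    simp [twist, hb]
  · rintro ⟨z, hz, hadj⟩ hb
    have hz' : ∀ r, ∃ g : S.GadgetVertex, z r = .inr g ∧ g.x = β ∧ g.y = γ ∧ (g.t : ℕ) = t ∧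
        g.r = r.castLE hP := by
      intro r
      obtain ⟨⟨g, hg⟩, h₀, h₁, h₂⟩ := hz r
      rw [hg] at h₀ h₁ h₂
      have h₂ : S.lab (Nat.pair g.t g.r) = S.lab (Nat.pair t r) := h₂
      have h₃ := S.lab_inj (g.pair_lt.trans S.pow_bits_gt)
        ((S.pair_lt t htP r (r.2.trans_le hP)).trans S.pow_bits_gt) h₂
      obtain ⟨h₄, h₅⟩ := Nat.pair_eq_pair.1 h₃
      exact ⟨g, hg, h₀, h₁, h₄, Fin.ext h₅⟩
    choose g hg hx hy ht hr using hz'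
    let c : Fin (rows (S.lev γ)) → Fin S.bound := Fin.castLE hP
    -- The extra 1 above the diagonal turns the clique equations of a twisted gadget into symmetry
    -- of `M`, so its entries sum to 0. But every vector of the clique is even, so the sum is that
    -- single 1.
    let M : Fin (rows (S.lev γ)) → Fin (rows (S.lev γ)) → ZMod 2 := fun r s =>
      (g r).u (c s) + if (r : ℕ) = 0 ∧ (s : ℕ) = 1 then 1 else 0
    have hM : ∑ r, ∑ s, M r s = 0 := by
      refine sum_symmetric_eq_zero Finset.univ M (fun r _ => ?_) fun r _ s _ hrs => ?_
      · have := (g r).row.1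
        rw [hr r] at this
        have h01 : ¬ ((r : ℕ) = 0 ∧ (r : ℕ) = 1) := by omega
        simp only [M, c, this, h01, if_false, add_zero]
      · have h₁ := hadj r s hrs
        have hne : (g r).r ≠ (g s).r := by
          rw [hr r, hr s]
          exact fun h => hrs (Fin.castLE_injective hP h)
        rw [hg r, hg s, adj_gadget_iff ((hx r).trans (hx s).symm) ((hy r).trans (hy s).symm)
          (Fin.ext ((ht r).trans (ht s).symm)) hne, hx r, hy r, ht r, hr r, hr s] at h₁
        simp only [M, c]
        rw [add_add_add_comm, h₁]
        simp only [twist, hb, true_and, Fin.val_castLE]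
        by_cases h₂ : (r : ℕ) = 0 ∧ (s : ℕ) = 1
        · simp only [h₂, true_or, if_true, and_self]
          decide
        · by_cases h₃ : (r : ℕ) = 1 ∧ (s : ℕ) = 0
          · simp [h₃]
            decide
          · have h₄ : ¬ ((s : ℕ) = 0 ∧ (r : ℕ) = 1) := fun h => h₃ ⟨h.2, h.1⟩
            simp [h₂, h₃, h₄]
    have hrow : ∀ r, ∑ s, (g r).u (c s) = 0 := by
      intro r
      obtain ⟨-, h₁, h₂⟩ := (g r).row
      rw [hy r] at h₁
      rw [← h₂, ← Finset.sum_image (s := Finset.univ) (g := c) (f := (g r).u)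
        fun _ _ _ _ h => Fin.castLE_injective hP h]
      refine Finset.sum_subset (Finset.subset_univ _) fun s _ hs => h₁ s ?_
      by_contra h
      exact hs (Finset.mem_image.2 ⟨⟨s, Nat.not_le.1 h⟩, Finset.mem_univ _, rfl⟩)
    simp only [M, Finset.sum_add_distrib, hrow, zero_add] at hM
    rw [Finset.sum_eq_single (⟨0, by omega⟩ : Fin (rows (S.lev γ))),
      Finset.sum_eq_single (⟨1, by omega⟩ : Fin (rows (S.lev γ)))] at hM
    · simp at hM
    · intro s _ hs
      have : ¬ (s : ℕ) = 1 := fun h => hs (Fin.ext h)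
      simp [this]
    · exact fun h => absurd (Finset.mem_univ _) h
    · intro r _ hr
      have : ¬ (r : ℕ) = 0 := fun h => hr (Fin.ext h)
      simp [this]
    · exact fun h => absurd (Finset.mem_univ _) h

end Skeleton

/-! ### Uniform definability in the family of graphs -/

section Family

variable {roles rows : ℕ → ℕ} {S : ℕ → Skeleton roles rows}
  {b : (n : ℕ) → (S n).B → (S n).B → ℕ → Prop} {α : Type}

local notation "Def" => DefinableAlong Filter.atTop (fun n => Skeleton.graph (S n) (b n))

theorem definable_adj (s t : α) : Def fun n a => (S n).Adj (b n) (a s) (a t) :=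
  .adj s t

theorem definable_isLabel (s : α) : Def fun n a => (S n).IsLabel (a s) :=
  (definable_adj s s).not.congr fun n a => by rw [Skeleton.adj_self_iff, not_not]

theorem definable_isPoint (s : α) : Def fun n a => (S n).IsPoint (a s) := by
  refine DefinableAlong.congr (.and (definable_adj s s) (.all ?_)) fun n a =>
    (Skeleton.isPoint_iff (b n) (a s)).symm
  exact .imp (definable_adj (Sum.inl s) (Sum.inr ())) (definable_adj (Sum.inr ()) (Sum.inr ()))

theorem definable_isGadget (s : α) : Def fun n a => (S n).IsGadget (a s) :=
  DefinableAlong.congr (.and (definable_adj s s) (.not (definable_isPoint s))) fun n a =>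
    (Skeleton.isGadget_iff (b n) (a s)).symm

theorem definable_isCoord (c : Fin 3) (s t : α) :
    Def fun n a => a t = Sum.inl ((S n).coord (a s) c) := by
  match c with
  | 0 =>
    exact DefinableAlong.congr (.or (.and (.not (definable_isGadget s)) (.eq t s))
      (.and (definable_isGadget s) (.and (.not (definable_isGadget t)) (definable_adj t s))))
      fun n a => (Skeleton.isCoord_zero_iff (b n) (a s) (a t)).symm
  | 1 =>
    exact DefinableAlong.congr (.or (.and (.not (definable_isGadget s)) (.eq t s))
      (.and (definable_isGadget s) (.and (definable_isPoint t) (definable_adj s t))))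
      fun n a => (Skeleton.isCoord_one_iff (b n) (a s) (a t)).symm
  | 2 =>
    exact DefinableAlong.congr (.or (.and (.not (definable_isGadget s)) (.eq t s))
      (.and (definable_isGadget s) (.and (definable_isLabel t) (definable_adj s t))))
      fun n a => (Skeleton.isCoord_two_iff (b n) (a s) (a t)).symm

theorem eventually_lt_pow_bits (hS : ∀ n, n ≤ (S n).bits)
    (c : ℕ) : ∀ᶠ n in Filter.atTop, c < 2 ^ (S n).bits :=
  Filter.eventually_atTop.2 ⟨c, fun n hn => (hn.trans (hS n)).trans_lt (S n).pow_bits_gt⟩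

/-- The positions of the binary digits 1 of `c` are smaller than `c`, so their labels are definable
already. The label numbered `c` exists only in large skeletons, hence the restriction to almost all
`n`. -/
theorem definable_lab (hS : ∀ n, n ≤ (S n).bits) (c : ℕ) : ∀ {α : Type} (s : α),
    Def fun n a => a s = Sum.inl ((S n).lab c) := by
  induction c using Nat.strong_induction_on with
  | _ c ih =>
    intro α s
    have h : Def fun n (a : α → _) => (S n).IsLabel (a s) ∧ ∀ v, (S n).IsLabel v →
        ((S n).Adj (b n) v (a s) ↔ ∃ d : Fin c, c.testBit d = true ∧ v = Sum.inl ((S n).lab d)) := by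
      refine .and (definable_isLabel s) (.all (.imp (definable_isLabel (Sum.inr ()))
        (.iff (definable_adj (Sum.inr ()) (Sum.inl s)) (.exists_finite fun d => .and (.const _) ?_))))
      exact ih d d.2 (Sum.inr ())
    refine h.congr_eventually ?_
    filter_upwards [eventually_lt_pow_bits hS c] with n hn a
    rw [Skeleton.eq_lab_iff_adj (b n) hn]
    refine and_congr_right fun _ => forall_congr' fun v => imp_congr_right fun _ =>
      iff_congr Iff.rfl ⟨fun ⟨d, hd⟩ => ⟨d, hd⟩, fun ⟨d, hd, hv⟩ => ⟨⟨d, ?_⟩, hd, hv⟩⟩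
    exact Nat.lt_two_pow_self.trans_le (Nat.ge_two_pow_of_testBit hd)

theorem definable_isLevelOf (hS : ∀ n, n ≤ (S n).bits)
    (s t : α) : Def fun n a => (S n).IsLevelOf (a s) (a t) :=
  DefinableAlong.congr (.or (.and (definable_isLabel s) (definable_lab hS 0 t))
    (.and (definable_isPoint s) (.and (definable_isLabel t) (definable_adj t s))))
    fun n a => (Skeleton.isLevelOf_iff (b n) (a s) (a t)).symm

theorem definable_lev_eq (hS : ∀ n, n ≤ (S n).bits) (l : ℕ) (s : α) :
    Def fun n a => ∃ β, a s = Sum.inl β ∧ (S n).lev β = l := by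
  have h : Def fun n (a : α → _) => ∃ w, (S n).IsLevelOf (a s) w ∧ w = Sum.inl ((S n).lab l) :=
    .ex (.and (definable_isLevelOf hS (Sum.inl s) (Sum.inr ())) (definable_lab hS l (Sum.inr ())))
  refine h.congr_eventually ?_
  filter_upwards [eventually_lt_pow_bits hS l] with n hn a
  constructor
  · rintro ⟨_, ⟨β, hβ, rfl⟩, hw⟩
    exact ⟨β, hβ, (S n).lab_inj ((S n).lev_lt_pow β) hn (Sum.inl.inj hw)⟩
  · rintro ⟨β, hβ, rfl⟩
    exact ⟨_, ⟨β, hβ, rfl⟩, rfl⟩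

theorem definable_lev_lt (hS : ∀ n, n ≤ (S n).bits) (l : ℕ) (s : α) :
    Def fun n a => ∃ β, a s = Sum.inl β ∧ (S n).lev β < l :=
  DefinableAlong.congr (.exists_finite fun i : Fin l => definable_lev_eq hS i s) fun _ _ =>
    ⟨fun ⟨i, β, hβ, hi⟩ => ⟨β, hβ, hi ▸ i.2⟩, fun ⟨β, hβ, hi⟩ => ⟨⟨_, hi⟩, β, hβ, rfl⟩⟩

open Classical in
theorem definable_flag (hS : ∀ n, n ≤ (S n).bits)
    {p : (n : ℕ) → (α → (S n).Vertex) → Prop} (hp : Def p) (t : α) :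
    Def fun n a => a t = Sum.inl ((S n).lab (if p n a then 1 else 0)) :=
  DefinableAlong.congr (.or (.and hp (definable_lab hS 1 t))
    (.and hp.not (definable_lab hS 0 t))) fun n a => by
      by_cases h : p n a <;> simp [h]

/-- The information about a tuple is definable. -/
theorem definable_info (hS : ∀ n, n ≤ (S n).bits)
    (l : ℕ) {m : ℕ} (o : Slot m) (g : Fin m → α) (t : α) :
    Def fun n a => a t = Sum.inl ((S n).info (b n) l (fun i => a (g i)) o) := by
  cases o with
  | unit => exact definable_lab hS 0 t
  | level s c =>
    have h : Def fun n (a : α → _) => ∃ w, w = Sum.inl ((S n).coord (a (g s)) c) ∧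
        (S n).IsLevelOf w (a t) :=
      .ex (.and (definable_isCoord c (Sum.inl (g s)) (Sum.inr ()))
        (definable_isLevelOf hS (Sum.inr ()) (Sum.inl t)))
    refine h.congr fun n a => ?_
    simp [Skeleton.IsLevelOf, Skeleton.info]
  | low s c =>
    have h : Def fun n (a : α → _) => ∃ w, w = Sum.inl ((S n).coord (a (g s)) c) ∧
        (((∃ β, w = Sum.inl β ∧ (S n).lev β < l) ∧ a t = w) ∨
          (¬ (∃ β, w = Sum.inl β ∧ (S n).lev β < l) ∧ a t = Sum.inl ((S n).lab 0))) :=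
      .ex (.and (definable_isCoord c (Sum.inl (g s)) (Sum.inr ()))
        (.or (.and (definable_lev_lt hS l (Sum.inr ())) (.eq (Sum.inl t) (Sum.inr ())))
          (.and (.not (definable_lev_lt hS l (Sum.inr ()))) (definable_lab hS 0 (Sum.inl t)))))
    refine h.congr fun n a => ?_
    by_cases hl : (S n).lev ((S n).coord (a (g s)) c) < l
    · simp [Skeleton.info, hl]
    · simp only [Skeleton.info, hl, exists_eq_left, Sum.inl.injEq, exists_eq_left', if_false,
        false_and, false_or, not_false_eq_true, true_and]
  | eq s c s' c' =>
    have h : Def fun n (a : α → _) => (S n).coord (a (g s)) c = (S n).coord (a (g s')) c' := by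
      have h' : Def fun n (a : α → _) => ∃ w, w = Sum.inl ((S n).coord (a (g s)) c) ∧
          w = Sum.inl ((S n).coord (a (g s')) c') :=
        .ex (.and (definable_isCoord c (Sum.inl (g s)) (Sum.inr ()))
          (definable_isCoord c' (Sum.inl (g s')) (Sum.inr ())))
      refine h'.congr fun n a => ?_
      simp
    exact definable_flag hS h t
  | adj s s' => exact definable_flag hS (definable_adj (g s) (g s')) t
  | diff s s' =>
    refine DefinableAlong.congr (.and (definable_isLabel t) (.all (.imp
      (definable_isLabel (Sum.inr ())) (.iff (definable_adj (Sum.inr ()) (Sum.inl t)) (.ex (.and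
      (definable_isGadget (Sum.inr ())) (.and (definable_adj (Sum.inr ()) (Sum.inl (Sum.inr ())))
      (.not (.iff (definable_adj (Sum.inr ()) (Sum.inl (Sum.inl (g s))))
        (definable_adj (Sum.inr ()) (Sum.inl (Sum.inl (g s'))))))))))))) fun n a =>
        (Skeleton.eq_lab_diff_iff (b n) (a (g s)) (a (g s')) (a t)).symm

/-- The twists of the gadgets of a fixed level and role are definable. -/
theorem definable_twisted (hS : ∀ n, n ≤ (S n).bits)
    {l r : ℕ} (hr : r < roles l) (hrows : 2 ≤ rows l) (s t : α) :
    Def fun n a => ∃ β γ, a s = Sum.inl β ∧ a t = Sum.inl γ ∧ (S n).lev β < l ∧ (S n).lev γ = l ∧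
      b n β γ r := by
  have h : Def fun n (a : α → _) => ((∃ β, a s = Sum.inl β ∧ (S n).lev β < l) ∧
      (∃ γ, a t = Sum.inl γ ∧ (S n).lev γ = l)) ∧ ¬ ∃ z : Fin (rows l) → (S n).Vertex,
      (∀ i, (S n).IsGadget (z i) ∧ a s = Sum.inl ((S n).coord (z i) 0) ∧
        a t = Sum.inl ((S n).coord (z i) 1) ∧
        ∃ w : (S n).Vertex, w = Sum.inl ((S n).coord (z i) 2) ∧ w = Sum.inl ((S n).lab (Nat.pair r i))) ∧
      ∀ i j, i ≠ j → (S n).Adj (b n) (z i) (z j) := by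
    refine .and (.and (definable_lev_lt hS l s) (definable_lev_eq hS l t)) (.not ?_)
    refine .exists_tuple (.and (.forall_finite fun i => ?_)
      (.forall_finite fun i => .forall_finite fun j => .imp (.const _)
        (definable_adj (Sum.inr i) (Sum.inr j))))
    refine .and (definable_isGadget (Sum.inr i)) (.and (definable_isCoord 0 (Sum.inr i) (Sum.inl s))
      (.and (definable_isCoord 1 (Sum.inr i) (Sum.inl t)) (.ex (.and ?_ ?_))))
    · exact definable_isCoord 2 (Sum.inl (Sum.inr i)) (Sum.inr ())
    · exact definable_lab hS _ (Sum.inr ())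
  refine h.congr fun n a => ?_
  constructor
  · rintro ⟨⟨⟨β, hβ, hβl⟩, γ, hγ, hγl⟩, hz⟩
    refine ⟨β, γ, hβ, hγ, hβl, hγl, ?_⟩
    by_contra hb
    obtain ⟨z, hz₁, hz₂⟩ := (Skeleton.not_twisted_iff (b n) hβl hγl hr hrows).1 hb
    refine hz ⟨z, fun i => ?_, hz₂⟩
    obtain ⟨h₁, h₂, h₃, h₄⟩ := hz₁ i
    exact ⟨h₁, by rw [h₂, hβ], by rw [h₃, hγ], _, rfl, by rw [h₄]⟩
  · rintro ⟨β, γ, hβ, hγ, hβl, hγl, hb⟩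
    refine ⟨⟨⟨β, hβ, hβl⟩, γ, hγ, hγl⟩, fun ⟨z, hz₁, hz₂⟩ => ?_⟩
    refine (Skeleton.not_twisted_iff (b n) hβl hγl hr hrows).2 ⟨z, fun i => ?_, hz₂⟩ hb
    obtain ⟨h₁, h₂, h₃, w, hw, hw'⟩ := hz₁ i
    rw [hβ] at h₂
    rw [hγ] at h₃
    exact ⟨h₁, (Sum.inl.inj h₂).symm, (Sum.inl.inj h₃).symm, Sum.inl.inj (hw.symm.trans hw')⟩

end Family

/-! ### Graphs that store the truth tables of queries -/

section Tables

variable (q : ℕ → PebbleQuery)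

/-- The number of roles on level `l`: one for each piece of information about the arguments of the
query `q l`. -/
noncomputable def queryRoles (l : ℕ) : ℕ := Nat.card (Slot (q l).arity)

/-- The number of rows of the gadgets of level `l`. -/
def queryRows (l : ℕ) : ℕ := 2 + ∑ i ∈ Finset.range (l + 1), ((q i).arity + (q i).width)

theorem lt_queryRows {l i : ℕ} (h : l ≤ i) :
    (q l).arity < queryRows q i ∧ (q l).width < queryRows q i := by
  have := Finset.single_le_sum (f := fun i => (q i).arity + (q i).width)
    (fun _ _ => Nat.zero_le _) (Finset.mem_range.2 (show l < i + 1 from Nat.lt_succ_of_le h))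
  unfold queryRows
  omega

/-- The role that belongs to a piece of information. -/
noncomputable def Slot.role {m : ℕ} (o : Slot m) : ℕ := Finite.equivFin (Slot m) o

variable {q}

theorem Slot.role_lt {l : ℕ} (o : Slot (q l).arity) : o.role < queryRoles q l :=
  (Finite.equivFin _ o).2

theorem Slot.role_injective {m : ℕ} : Function.Injective (Slot.role (m := m)) :=
  fun _ _ h => (Finite.equivFin _).injective (Fin.ext h)

variable (S : Skeleton (queryRoles q) (queryRows q))

namespace Skeleton

/-- The truth table of the query `q l`, in terms of the information about its arguments, for the
graphs that agree with `b` below level `l`. -/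
def Table (b : S.B → S.B → ℕ → Prop) (l : ℕ) (v : ℕ → S.B) : Prop :=
  ∃ b' : S.B → S.B → ℕ → Prop, (∀ x y t, S.lev y < l → (b x y t ↔ b' x y t)) ∧
    ∃ a : Fin (q l).arity → S.Vertex, (∀ o, S.info b' l a o = v o.role) ∧ (q l).rel (S.graph b') a

theorem Table.congr {b c : S.B → S.B → ℕ → Prop} {l : ℕ}
    (h : ∀ x y t, S.lev y < l → (b x y t ↔ c x y t)) (v : ℕ → S.B) :
    S.Table b l v ↔ S.Table c l v := by
  constructor
  · rintro ⟨b', hb', ha⟩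
    exact ⟨b', fun x y t hy => (h x y t hy).symm.trans (hb' x y t hy), ha⟩
  · rintro ⟨b', hb', ha⟩
    exact ⟨b', fun x y t hy => (h x y t hy).trans (hb' x y t hy), ha⟩

/-- The twists of the gadgets of level below `l`. -/
def twistsBelow : ℕ → S.B → S.B → ℕ → Prop
  | 0, _, _, _ => False
  | l + 1, x, y, t => (S.lev y = l ∧ S.levels.dec y t = x ∧
      S.Table (twistsBelow l) l (S.levels.dec y)) ∨ (S.lev y ≠ l ∧ twistsBelow l x y t)

/-- The twists of all gadgets. -/
def twists (x y : S.B) (t : ℕ) : Prop := S.twistsBelow (S.lev y + 1) x y t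

theorem twistsBelow_iff {l : ℕ} {x y : S.B} {t : ℕ} (h : S.lev y < l) :
    S.twistsBelow l x y t ↔ S.twists x y t := by
  induction l with
  | zero => exact absurd h (Nat.not_lt_zero _)
  | succ l ih =>
    by_cases hl : S.lev y = l
    · subst hl
      rfl
    · rw [← ih (by omega)]
      simp [twistsBelow, hl]

theorem twists_iff {x y : S.B} {t : ℕ} : S.twists x y t ↔ S.levels.dec y t = x ∧
    S.Table S.twists (S.lev y) (S.levels.dec y) := by
  rw [← Table.congr S fun x y t hy => S.twistsBelow_iff hy]
  simp [twists, twistsBelow]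

/-- The truth table of `q l` is stored by the gadgets of level `l`. -/
theorem rel_iff_exists_twists {l : ℕ} (hl : 0 < l) (hlS : l ≤ S.height)
    (a : Fin (q l).arity → S.Vertex) :
    (q l).rel (S.graph S.twists) a ↔
      ∃ y, S.lev y = l ∧ ∀ o, S.twists (S.info S.twists l a o) y o.role := by
  constructor
  · intro ha
    obtain ⟨v, hv⟩ : ∃ v : ℕ → S.B, ∀ o : Slot (q l).arity, v o.role = S.info S.twists l a o :=
      ⟨Function.extend Slot.role (S.info S.twists l a) fun _ => S.lab 0,
        fun o => Slot.role_injective.extend_apply _ _ o⟩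
    have hlow : ∀ t < queryRoles q l, S.lev (v t) < l := by
      intro t ht
      have : t = ((Finite.equivFin (Slot (q l).arity)).symm ⟨t, ht⟩).role := by
        simp [Slot.role]
      rw [this, hv]
      exact S.lev_info_lt _ hl _ _
    obtain ⟨y, hy, hdec⟩ := S.levels.exists_dec l hl hlS v hlow
    have hdec' : ∀ o : Slot (q l).arity, S.levels.dec y o.role = S.info S.twists l a o :=
      fun o => (hdec _ o.role_lt).trans (hv o)
    refine ⟨y, hy, fun o => S.twists_iff.2 ⟨hdec' o, ?_⟩⟩
    rw [show S.lev y = l from hy]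
    exact ⟨S.twists, fun _ _ _ _ => Iff.rfl, a, fun o => (hdec' o).symm, ha⟩
  · rintro ⟨y, rfl, hy⟩
    -- The slot `unit` guarantees a gadget from which the table can be read, even if the query has
    -- no arguments.
    obtain ⟨b', hb', a', ha', hrel⟩ := (S.twists_iff.1 (hy .unit)).2
    refine (rel_iff_of_info_eq (q (S.lev y)) hl (fun i hi _ => lt_queryRows q hi) hb' ?_).2 hrel
    funext o
    rw [ha' o, (S.twists_iff.1 (hy o)).1]

end Skeleton

end Tables

/-- The defining formula guesses the tuple `v` of information and the point `w` coding it, and tests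
the twists by cliques. It uses a fixed number of variables, as the roles and rows of level `l` do
not depend on `n`. -/
theorem definableAlong_rel {q : ℕ → PebbleQuery}
    {S : ℕ → Skeleton (queryRoles q) (queryRows q)} (hS : ∀ n, (S n).height = n) {l : ℕ}
    (hl : 0 < l) :
    DefinableAlong Filter.atTop (fun n => (S n).graph (S n).twists)
      fun n => (q l).rel ((S n).graph (S n).twists) := by
  have hbits : ∀ n, n ≤ (S n).bits := fun n => by
    have := (S n).height_lt
    rw [hS n] at this
    exact this.le
  have h : DefinableAlong Filter.atTop (fun n => (S n).graph (S n).twists)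
      fun n (a : Fin (q l).arity → (S n).Vertex) => ∃ v : Slot (q l).arity → (S n).Vertex,
        (∀ o, v o = Sum.inl ((S n).info (S n).twists l a o)) ∧
        ∃ w : (S n).Vertex, ∀ o, ∃ β γ, v o = Sum.inl β ∧ w = Sum.inl γ ∧ (S n).lev β < l ∧
          (S n).lev γ = l ∧ (S n).twists β γ o.role := by
    refine .exists_tuple (.and (.forall_finite fun o => ?_) (.ex (.forall_finite fun o => ?_)))
    · exact definable_info (b := fun n => (S n).twists) hbits l o Sum.inl (Sum.inr o)
    · exact definable_twisted (b := fun n => (S n).twists) hbits o.role_lt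
        (by unfold queryRows; omega) (Sum.inl (Sum.inr o)) (Sum.inr ())
  refine h.congr_eventually ?_
  filter_upwards [Filter.eventually_ge_atTop l] with n hn a
  rw [(S n).rel_iff_exists_twists hl (hn.trans (hS n).ge)]
  constructor
  · rintro ⟨v, hv, w, hw⟩
    obtain ⟨_, γ, -, rfl, -, hγ, -⟩ := hw .unit
    refine ⟨γ, hγ, fun o => ?_⟩
    obtain ⟨β, γ', hβ, hγ', -, -, ht⟩ := hw o
    rw [hv o] at hβ
    rwa [Sum.inl.inj hβ, Sum.inl.inj hγ']
  · rintro ⟨y, hy, ht⟩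
    exact ⟨_, fun o => rfl, .inl y, fun o =>
      ⟨_, y, rfl, rfl, (S n).lev_info_lt _ hl a o, hy, ht o⟩⟩

/-! ### Unbounded inductions -/

/-- The formula `∀ y, E y v → ¬ E y y → P y`. -/
def accessibleFormula : (graphPredLang 1).Formula (Fin 1 ⊕ Fin 0) :=
  .all (.imp (.rel (n := 1) (GraphPredRel.adj : (graphPredLang 1).Relations 2)
      ![.var (.inr 0), .var (.inl (.inl 0))])
    (.imp (.imp (.rel (GraphPredRel.adj : (graphPredLang 1).Relations 2)
      ![.var (.inr 0), .var (.inr 0)]) .falsum)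
      (.rel (GraphPredRel.pred : (graphPredLang 1).Relations 1) ![.var (.inr 0)])))

theorem predPolarity_accessibleFormula : PredPolarity true accessibleFormula := by
  simp [accessibleFormula, PredPolarity, GraphPredRel.Allowed]

theorem mem_stage_succ_accessibleFormula (G : FinDigraph) (a : Fin 0 → G.V) (i : ℕ)
    (v : Fin 1 → G.V) :
    v ∈ G.stage accessibleFormula a (i + 1) ↔ ∀ y, G.graph.Adj y (v 0) → ¬ G.graph.Adj y y →
      (fun _ => y) ∈ G.stage accessibleFormula a i := by
  rw [FinDigraph.stage, Function.iterate_succ_apply']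
  change (∀ y : G.V, (G.graph.Adj _ _ → (G.graph.Adj _ _ → False) → _ ∈ _)) ↔ _
  refine forall_congr' fun y => imp_congr Iff.rfl (imp_congr Iff.rfl ?_)
  refine Eq.to_iff (congrArg (· ∈ G.stage accessibleFormula a i) ?_)
  funext j
  rw [Subsingleton.elim j 0]
  rfl

/-- The numbers `0, 1, 2, 4, 16, …`. -/
def tower : ℕ → ℕ
  | 0 => 0
  | k + 1 => 2 ^ tower k

/-- The number `2 ^ tower k` has a single binary digit 1, at position `tower k`. Its label therefore
enters exactly one stage after the label of `tower k`. -/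
theorem Skeleton.lab_tower_mem_stage_iff {roles rows : ℕ → ℕ} {S : Skeleton roles rows}
    (b : S.B → S.B → ℕ → Prop) (a : Fin 0 → S.Vertex) {k : ℕ} (hk : tower k < 2 ^ S.bits) :
    (fun _ => .inl (S.lab (tower k))) ∉ (S.graph b).stage accessibleFormula a k ∧
      (fun _ => .inl (S.lab (tower k))) ∈ (S.graph b).stage accessibleFormula a (k + 1) := by
  have hpred : ∀ {d : ℕ}, d < 2 ^ S.bits → ∀ y, S.Adj b y (.inl (S.lab d)) → ¬ S.Adj b y y →
      ∃ s, d.testBit s = true ∧ y = .inl (S.lab s) := by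
    intro d hd y hy hyy
    rw [adj_self_iff, not_not] at hyy
    exact (((eq_lab_iff_adj b hd _).1 rfl).2 y hyy).1 hy
  induction k with
  | zero =>
    refine ⟨fun h => h, (mem_stage_succ_accessibleFormula _ _ _ _).2 fun y hy hyy => ?_⟩
    obtain ⟨s, hs, -⟩ := hpred hk y hy hyy
    simp [tower] at hs
  | succ k ih =>
    have hlt : tower k < 2 ^ S.bits := lt_trans Nat.lt_two_pow_self hk
    obtain ⟨h₁, h₂⟩ := ih hlt
    constructor
    · intro h
      refine h₁ ((mem_stage_succ_accessibleFormula _ _ _ _).1 h _ ?_ ?_)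
      · refine (((eq_lab_iff_adj b hk _).1 rfl).2 _ ?_).2 ⟨tower k, ?_, rfl⟩
        · simpa using S.levels.lev_lab _
        · simp [tower]
      · change ¬ S.Adj b (.inl (S.lab (tower k))) (.inl (S.lab (tower k)))
        rw [adj_self_iff, not_not]
        simpa using S.levels.lev_lab _
    · refine (mem_stage_succ_accessibleFormula _ _ _ _).2 fun y hy hyy => ?_
      obtain ⟨s, hs, rfl⟩ := hpred hk y hy hyy
      simp only [tower, Nat.testBit_two_pow, decide_eq_true_eq] at hs
      subst hs
      exact h₂

/-- Countably many pebble queries become first-order expressible on a set of graphs with fixed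
points of unbounded depth. -/
theorem exists_family_expressing (q : ℕ → PebbleQuery) :
    ∃ J : ℕ → FinDigraph, AdmitsUnboundedFixedPoints (Set.range J) ∧
      ∀ i, FOExpressibleOn (Set.range J) (q i).rel := by
  choose S hS using
    -- Level 0 is taken by the labels, so query `i` is stored on level `i + 1`.
    Skeleton.exists_height (queryRoles fun l => q (l - 1)) (queryRows fun l => q (l - 1))
  refine ⟨fun n => (S n).graph (S n).twists,
    ⟨1, 0, accessibleFormula, predPolarity_accessibleFormula, ?_⟩, fun i => ?_⟩
  · rintro ⟨j, hj⟩
    -- The graph with index `tower j` has that height, which is less than `bits`, so it contains the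
    -- label of `tower j`, a label that is still missing at stage `j`.
    have hlt : tower j < 2 ^ (S (tower j)).bits := by
      have := (S (tower j)).height_lt
      rw [hS] at this
      exact this.trans (S (tower j)).pow_bits_gt
    obtain ⟨h₁, h₂⟩ := Skeleton.lab_tower_mem_stage_iff (S (tower j)).twists Fin.elim0 hlt
    refine h₁ ?_
    rw [hj _ ⟨tower j, rfl⟩]
    exact Set.mem_iUnion.2 ⟨j + 1, h₂⟩
  · exact (q i).foExpressibleOn_range (definableAlong_rel (q := fun l => q (l - 1)) hS i.succ_pos)

theorem mainTheorem3 :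
    (∃ J : ℕ → FinDigraph,
      AdmitsUnboundedFixedPoints (Set.range J) ∧
      ∀ (m : ℕ) (φ : FPCFormula m), FOExpressibleOn (Set.range J) φ.Realize) ∧
    (∀ S : Set LCountFormula.{u}, S.Countable →
      ∃ J : ℕ → FinDigraph,
        AdmitsUnboundedFixedPoints (Set.range J) ∧
        ∀ φ ∈ S, FOExpressibleOn (Set.range J) φ.Realize) := by
  constructor
  · have : Nonempty (Σ m, FPCFormula m) := ⟨2, .adj 0 1, trivial⟩
    obtain ⟨e, he⟩ := exists_surjective_nat (Σ m, FPCFormula m)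
    obtain ⟨J, hJ, h⟩ := exists_family_expressing fun n => (e n).2.toPebbleQuery
    refine ⟨J, hJ, fun m φ => ?_⟩
    obtain ⟨n, hn⟩ := he ⟨m, φ⟩
    have := h n
    rw [hn] at this
    exact this
  · intro S hS
    rcases S.eq_empty_or_nonempty with rfl | hne
    -- The empty set admits no enumeration; a trivial query stands in.
    · obtain ⟨J, hJ, -⟩ := exists_family_expressing fun _ =>
        ⟨0, 0, fun _ _ => True, fun _ _ _ _ _ _ _ => Iff.rfl⟩
      exact ⟨J, hJ, fun φ hφ => absurd hφ (Set.notMem_empty φ)⟩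
    · obtain ⟨e, rfl⟩ := hS.exists_eq_range hne
      obtain ⟨J, hJ, h⟩ := exists_family_expressing fun n => (e n).toPebbleQuery
      refine ⟨J, hJ, ?_⟩
      rintro _ ⟨n, rfl⟩
      exact h n
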